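/- Let $A$ be a spectrum with a decreasing bifiltration, i.e. a commutative diagram of spectra $F^{s,t}A$, $s,t\in\mathbb Z\cup\{-\infty\}$, with compatible maps $F^{s,t}A\to F^{s-1,t}A$ and $F^{s,t}A\to F^{s,t-1}A$ whose two composites $F^{s,t}A\to F^{s-1,t-1}A$ agree, such that $F^{-\infty,t}A=\operatorname{hocolim}_{s}F^{s,t}A$ (including $t=-\infty$), $F^{s,-\infty}A=\operatorname{hocolim}_{t}F^{s,t}A$ (including $s=-\infty$), and $A=F^{-\infty,-\infty}A$. Suppose that $A$ is complete with respect to both filtrations: $\operatorname{holim}_{s\to\infty}F^{s,t}A\simeq *$ for every $t\in\mathbb Z\cup\{-\infty\}$, and $\operatorname{holim}_{t\to\infty}F^{s,t}A\simeq *$ for every $s\in\mathbb Z\cup\{-\infty\}$. Write $X/Y$ for the homotopy cofibre of a map $Y\to X$, and put $Gr^{v,t}A=F^{-\infty,t}A/F^{-\infty,t+1}A$, $Gr^{h,s}A=F^{s,-\infty}A/F^{s+1,-\infty}A$, and $$BiGr^{s,t}A=\frac{F^{s,t}A/F^{s,t+1}A}{F^{s+1,t}A/F^{s+1,t+1}A}\simeq\frac{F^{s,t}A/F^{s+1,t}A}{F^{s,t+1}A/F^{s+1,t+1}A}.$$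 Consider the following spectral sequences, all starting at $E_1$ and all with differentials lowering the total degree by one: 1. for each $t\in\mathbb Z$, $\pi_*BiGr^{*,t}A\Rightarrow\pi_*Gr^{v,t}A$, from the filtration $s\mapsto F^{s,t}A/F^{s,t+1}A$; 2. $\pi_*Gr^{v,*}A\Rightarrow\pi_*A$, from the filtration $t\mapsto F^{-\infty,t}A$; 3. for each $s\in\mathbb Z$, $\pi_*BiGr^{s,*}A\Rightarrow\pi_*Gr^{h,s}A$, from the filtration $t\mapsto F^{s,t}A/F^{s+1,t}A$; 4. $\pi_*Gr^{h,*}A\Rightarrow\pi_*A$, from the filtration $s\mapsto F^{s,-\infty}A$. If all nonzero differentials $d_r$, $r\ge1$, in the spectral sequences (1) and (2) go from even to odd total degree, then all nonzero differentials $d_r$, $r\ge1$, in the spectral sequences (3) and (4) go from even to odd total degree. (The total degree of a class in $\pi_n$ is $n$.) -/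

import Mathlib

open scoped unitInterval

universe u

namespace StableHomotopy

/-! ### Weak homotopy equivalences -/

/-- The map of sets of path components induced by a continuous map. -/
def mapComponents {S T : Type u} [TopologicalSpace S] [TopologicalSpace T] (f : C(S, T)) :
    ZerothHomotopy S → ZerothHomotopy T :=
  Quotient.map f (fun _ _ ⟨p⟩ => ⟨p.map f.continuous⟩)

/-- The map `π_n (S, x) → π_n (T, f x)` induced by a continuous map `f : S → T`. -/
def mapHomotopyGroup {S T : Type u} [TopologicalSpace S] [TopologicalSpace T] (f : C(S, T))
    (n : ℕ) (x : S) : HomotopyGroup.Pi n S x → HomotopyGroup.Pi n T (f x) :=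
  Quotient.map (fun γ => ⟨f.comp γ.1, fun y hy => congrArg f (γ.2 y hy)⟩)
    (fun _ _ ⟨H⟩ => ⟨H.compContinuousMap f⟩)

/-- A weak homotopy equivalence: a continuous map that is bijective on path components and on all
homotopy groups at all base points. -/
def IsWeakHomotopyEquiv {S T : Type u} [TopologicalSpace S] [TopologicalSpace T] (f : C(S, T)) :
    Prop :=
  Function.Bijective (mapComponents f) ∧
    ∀ (n : ℕ) (x : S), 1 ≤ n → Function.Bijective (mapHomotopyGroup f n x)

/-! ### Spectra -/

/-- A prespectrum: a sequence of pointed spaces `X k` (`k : ℤ`) with pointed structure maps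
`X k → Ω (X (k + 1))` (the adjoints of maps `Σ (X k) → X (k + 1)`). -/
structure Prespectrum where
  space : ℤ → Type u
  [top : ∀ k, TopologicalSpace (space k)]
  pt : ∀ k, space k
  deloop : ∀ k, C(space k, Path (pt (k + 1)) (pt (k + 1)))
  deloop_pt : ∀ k, deloop k (pt k) = Path.refl (pt (k + 1))

attribute [instance] Prespectrum.top

/-- A spectrum (an `Ω`-spectrum): the structure maps `X k → Ω (X (k + 1))` are weak homotopy
equivalences. -/
def Prespectrum.IsSpectrum (X : Prespectrum.{u}) : Prop :=
  ∀ k, IsWeakHomotopyEquiv (X.deloop k)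

/-- A map of (pre)spectra: pointed maps `X k → Y k` compatible with the structure maps. -/
structure Prespectrum.Hom (X Y : Prespectrum.{u}) where
  app : ∀ k, C(X.space k, Y.space k)
  app_pt : ∀ k, app k (X.pt k) = Y.pt k
  comm : ∀ k (x : X.space k) (v : I),
    Y.deloop k (app k x) v = app (k + 1) (X.deloop k x v)

/-- The homotopy group `π_{-k} X` of a spectrum `X`, i.e. the set of path components of the space
`X k`.  The grading is cohomological: `X.homotopy k` has degree `-k`.  This is used for
`Ω`-spectra and for homotopy fibres, shifts and homotopy limits of those, formed levelwise, which
are `Ω`-spectra again.  Only the underlying pointed set of the group is needed below. -/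
def Prespectrum.homotopy (X : Prespectrum.{u}) (k : ℤ) : Type u := ZerothHomotopy (X.space k)

/-- The zero element of `π_{-k} X`. -/
def Prespectrum.zero (X : Prespectrum.{u}) (k : ℤ) : X.homotopy k := ZerothHomotopy.mk (X.pt k)

/-- The map `π_{-k} X → π_{-k} Y` induced by a map of spectra. -/
def Prespectrum.Hom.onHomotopy {X Y : Prespectrum.{u}} (f : X.Hom Y) (k : ℤ) :
    X.homotopy k → Y.homotopy k :=
  mapComponents (f.app k)

/-- A spectrum is contractible if all of its homotopy groups vanish. -/
def Prespectrum.IsContractible (X : Prespectrum.{u}) : Prop :=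
  ∀ (k : ℤ) (x : X.homotopy k), x = X.zero k

/-! ### Homotopy cofibres -/

/-- The homotopy fibre over `y₀` of a continuous map `f : S → T`: points `x` of `S` together with
a path in `T` from `f x` to `y₀`. -/
def HoFiber {S T : Type u} [TopologicalSpace S] [TopologicalSpace T] (f : C(S, T)) (y₀ : T) :
    Type u :=
  {p : S × C(I, T) // p.2 0 = f p.1 ∧ p.2 1 = y₀}

namespace HoFiber

variable {S T S' T' : Type u} [TopologicalSpace S] [TopologicalSpace T] [TopologicalSpace S']
  [TopologicalSpace T']

instance (f : C(S, T)) (y₀ : T) : TopologicalSpace (HoFiber f y₀) :=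
  inferInstanceAs (TopologicalSpace {p : S × C(I, T) // p.2 0 = f p.1 ∧ p.2 1 = y₀})

/-- The base point of the homotopy fibre of a pointed map. -/
def base {f : C(S, T)} {x₀ : S} {y₀ : T} (h : f x₀ = y₀) : HoFiber f y₀ :=
  ⟨(x₀, ContinuousMap.const I y₀), h.symm, rfl⟩

/-- The map from the homotopy fibre of `f` to the loop space of the homotopy fibre of `f'` induced by
maps `S → Ω S'` and `T → Ω T'` compatible with `f` and `f'`. -/
def loopMap (f : C(S, T)) (f' : C(S', T')) (t₀ : T) {x₀ : S'} {y₀ : T'} (h : f' x₀ = y₀)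
    (e : C(S, Path x₀ x₀)) (e' : C(T, Path y₀ y₀)) (ht₀ : e' t₀ = Path.refl y₀)
    (comm : ∀ x v, e' (f x) v = f' (e x v)) :
    C(HoFiber f t₀, Path (base h) (base h)) where
  toFun z :=
    { toFun := fun v => ⟨(e z.1.1 v, ⟨fun w => e' (z.1.2 w) v, by fun_prop⟩),
        (congrArg (fun y => e' y v) z.2.1).trans (comm z.1.1 v),
        (congrArg (fun y => e' y v) z.2.2).trans (congrArg (fun p => p v) ht₀)⟩
      continuous_toFun := by
        refine Continuous.subtype_mk (Continuous.prodMk (by fun_prop) ?_) _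
        refine ContinuousMap.continuous_of_continuous_uncurry _ ?_
        have : Continuous fun p : I × I => e' (z.1.2 p.2) p.1 := by fun_prop
        exact this
      source' := by
        refine Subtype.ext (Prod.ext (e z.1.1).source (ContinuousMap.ext fun w => ?_))
        exact (e' (z.1.2 w)).source
      target' := by
        refine Subtype.ext (Prod.ext (e z.1.1).target (ContinuousMap.ext fun w => ?_))
        exact (e' (z.1.2 w)).target }
  continuous_toFun := by
    refine Path.continuous_uncurry_iff.mp ?_
    refine Continuous.subtype_mk (Continuous.prodMk ?_ ?_) _
    · have : Continuous fun q : HoFiber f t₀ × I => e q.1.1.1 q.2 :=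
        Continuous.eval (e.continuous.comp
          (continuous_fst.comp (continuous_subtype_val.comp continuous_fst))) continuous_snd
      exact this
    · refine ContinuousMap.continuous_of_continuous_uncurry _ ?_
      have h1 : Continuous fun q : (HoFiber f t₀ × I) × I => q.1.1.1.2 q.2 :=
        Continuous.eval (continuous_snd.comp (continuous_subtype_val.comp
          (continuous_fst.comp continuous_fst))) continuous_snd
      have h2 : Continuous fun q : (HoFiber f t₀ × I) × I => e' (q.1.1.1.2 q.2) q.1.2 :=
        Continuous.eval (e'.continuous.comp h1) (continuous_snd.comp continuous_fst)
      exact h2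

end HoFiber

/-- The homotopy cofibre of a map of spectra `f : X → Y`.  It is the suspension (the shift by one)
of the homotopy fibre of `f`: its `k`-th space is the homotopy fibre of
`X (k + 1) → Y (k + 1)` over the base point, and the structure maps are those of `X` and `Y`. -/
def Prespectrum.Hom.cofiber {X Y : Prespectrum.{u}} (f : X.Hom Y) : Prespectrum.{u} where
  space k := HoFiber (f.app (k + 1)) (Y.pt (k + 1))
  top k := inferInstanceAs (TopologicalSpace (HoFiber (f.app (k + 1)) (Y.pt (k + 1))))
  pt k := HoFiber.base (f.app_pt (k + 1))
  deloop k := HoFiber.loopMap (f.app (k + 1)) (f.app (k + 1 + 1)) (Y.pt (k + 1))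
    (f.app_pt (k + 1 + 1)) (X.deloop (k + 1)) (Y.deloop (k + 1)) (Y.deloop_pt (k + 1))
    (f.comm (k + 1))
  deloop_pt k := by
    refine Path.ext (funext fun v => Subtype.ext (Prod.ext ?_ (ContinuousMap.ext fun w => ?_)))
    · exact congrArg (fun q => q v) (X.deloop_pt (k + 1))
    · exact congrArg (fun q => q v) (Y.deloop_pt (k + 1))

/-- The map `Y → cofiber f` on `π_{-k}`.  A point `y` of `Y k` corresponds to a loop in
`Y (k + 1)`, and a loop is a point of the homotopy fibre lying over the base point of
`X (k + 1)`. -/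
def Prespectrum.Hom.toCofiber {X Y : Prespectrum.{u}} (f : X.Hom Y) (k : ℤ) :
    Y.homotopy k → f.cofiber.homotopy k :=
  mapComponents (T := HoFiber (f.app (k + 1)) (Y.pt (k + 1)))
    { toFun := fun y => ⟨(X.pt (k + 1), (Y.deloop k y).toContinuousMap),
        (Y.deloop k y).source.trans (f.app_pt (k + 1)).symm, (Y.deloop k y).target⟩
      continuous_toFun := by
        refine Continuous.subtype_mk (Continuous.prodMk continuous_const ?_) _
        exact continuous_induced_dom.comp (Y.deloop k).continuous }

/-- The connecting homomorphism `π_{-k} (cofiber f) → π_{-k-1} X`, induced by the projection of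
the homotopy fibre of `X (k + 1) → Y (k + 1)` to `X (k + 1)`. -/
def Prespectrum.Hom.boundary {X Y : Prespectrum.{u}} (f : X.Hom Y) (k : ℤ) :
    f.cofiber.homotopy k → X.homotopy (k + 1) :=
  mapComponents (S := HoFiber (f.app (k + 1)) (Y.pt (k + 1)))
    { toFun := fun z => z.1.1
      continuous_toFun := continuous_fst.comp continuous_subtype_val }

/-- The map of homotopy cofibres induced by a commutative square of spectra. -/
def Prespectrum.Hom.cofiberMap {X Y X' Y' : Prespectrum.{u}} (f : X.Hom Y) (f' : X'.Hom Y')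
    (a : X.Hom X') (b : Y.Hom Y')
    (sq : ∀ k x, b.app k (f.app k x) = f'.app k (a.app k x)) :
    f.cofiber.Hom f'.cofiber where
  app k :=
    { toFun := fun z : HoFiber (f.app (k + 1)) (Y.pt (k + 1)) =>
        (⟨(a.app (k + 1) z.1.1, (b.app (k + 1)).comp z.1.2),
          (congrArg (b.app (k + 1)) z.2.1).trans (sq (k + 1) z.1.1),
          (congrArg (b.app (k + 1)) z.2.2).trans (b.app_pt (k + 1))⟩ :
          HoFiber (f'.app (k + 1)) (Y'.pt (k + 1)))
      continuous_toFun := by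
        refine Continuous.subtype_mk (Continuous.prodMk ?_ ?_) _
        · exact (a.app (k + 1)).continuous.comp (continuous_fst.comp continuous_subtype_val)
        · exact (ContinuousMap.continuous_postcomp (b.app (k + 1))).comp
            (continuous_snd.comp continuous_subtype_val) }
  app_pt k := by
    refine Subtype.ext (Prod.ext (a.app_pt (k + 1)) (ContinuousMap.ext fun w => ?_))
    exact b.app_pt (k + 1)
  comm k z v := by
    refine Subtype.ext (Prod.ext (a.comm (k + 1) _ v) (ContinuousMap.ext fun w => ?_))
    exact b.comm (k + 1) _ v

/-! ### Filtered spectra -/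

/-- A decreasing filtration of (pre)spectra `⋯ → F^{s+1} → F^s → F^{s-1} → ⋯`, `s : ℤ`. -/
structure FilteredPrespectrum where
  obj : ℤ → Prespectrum.{u}
  map : ∀ {a b : ℤ}, a ≤ b → (obj b).Hom (obj a)
  map_refl : ∀ (a : ℤ) k (x : (obj a).space k), (map (le_refl a)).app k x = x
  map_trans : ∀ {a b c : ℤ} (h : a ≤ b) (h' : b ≤ c) k (x : (obj c).space k),
    (map h).app k ((map h').app k x) = (map (h.trans h')).app k x

namespace FilteredPrespectrum

variable (F : FilteredPrespectrum.{u})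

/-- The map `F^{s+1} → F^s`. -/
def step (s : ℤ) : (F.obj (s + 1)).Hom (F.obj s) := F.map (le_of_lt (lt_add_one s))

/-- The associated graded `Gr^s F = F^s / F^{s+1}`. -/
def gr (s : ℤ) : Prespectrum.{u} := (F.step s).cofiber

/-- The underlying set of the `k`-th space of the homotopy limit of `F`: a point `x s` in each
`F^s`, together with a path in `F^s` from `x s` to the image of `x (s + 1)`. -/
def HolimSpace (k : ℤ) : Type u :=
  {p : (∀ s, (F.obj s).space k) × (∀ s, C(I, (F.obj s).space k)) //
    ∀ s, p.2 s 0 = p.1 s ∧ p.2 s 1 = (F.step s).app k (p.1 (s + 1))}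

instance (k : ℤ) : TopologicalSpace (F.HolimSpace k) :=
  inferInstanceAs (TopologicalSpace
    {p : (∀ s, (F.obj s).space k) × (∀ s, C(I, (F.obj s).space k)) //
      ∀ s, p.2 s 0 = p.1 s ∧ p.2 s 1 = (F.step s).app k (p.1 (s + 1))})

/-- The base point of the homotopy limit. -/
def holimBase (k : ℤ) : F.HolimSpace k :=
  ⟨(fun s => (F.obj s).pt k, fun s => ContinuousMap.const I ((F.obj s).pt k)),
    fun s => ⟨rfl, ((F.step s).app_pt k).symm⟩⟩

/-- The structure maps of the homotopy limit, induced by those of the `F^s`. -/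
def holimDeloop (k : ℤ) :
    C(F.HolimSpace k, Path (F.holimBase (k + 1)) (F.holimBase (k + 1))) where
  toFun z :=
    { toFun := fun v => ⟨(fun s => (F.obj s).deloop k (z.1.1 s) v,
        fun s => ⟨fun w => (F.obj s).deloop k (z.1.2 s w) v, by fun_prop⟩),
        fun s => ⟨congrArg (fun y => (F.obj s).deloop k y v) (z.2 s).1,
          (congrArg (fun y => (F.obj s).deloop k y v) (z.2 s).2).trans
            ((F.step s).comm k _ v)⟩⟩
      continuous_toFun := by
        refine Continuous.subtype_mk (Continuous.prodMk (by fun_prop)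
          (continuous_pi fun s => ?_)) _
        refine ContinuousMap.continuous_of_continuous_uncurry _ ?_
        have : Continuous fun p : I × I => (F.obj s).deloop k (z.1.2 s p.2) p.1 := by fun_prop
        exact this
      source' := by
        refine Subtype.ext (Prod.ext (funext fun s => ?_)
          (funext fun s => ContinuousMap.ext fun w => ?_))
        · exact ((F.obj s).deloop k (z.1.1 s)).source
        · exact ((F.obj s).deloop k (z.1.2 s w)).source
      target' := by
        refine Subtype.ext (Prod.ext (funext fun s => ?_)
          (funext fun s => ContinuousMap.ext fun w => ?_))
        · exact ((F.obj s).deloop k (z.1.1 s)).target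
        · exact ((F.obj s).deloop k (z.1.2 s w)).target }
  continuous_toFun := by
    refine Path.continuous_uncurry_iff.mp ?_
    refine Continuous.subtype_mk (Continuous.prodMk (continuous_pi fun s => ?_)
      (continuous_pi fun s => ?_)) _
    · have : Continuous fun q : F.HolimSpace k × I => (F.obj s).deloop k (q.1.1.1 s) q.2 :=
        Continuous.eval (((F.obj s).deloop k).continuous.comp ((continuous_apply s).comp
          (continuous_fst.comp (continuous_subtype_val.comp continuous_fst)))) continuous_snd
      exact this
    · refine ContinuousMap.continuous_of_continuous_uncurry _ ?_
      have h0 : Continuous fun z : F.HolimSpace k => z.1.2 s :=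
        (continuous_apply s).comp (continuous_snd.comp continuous_subtype_val)
      have h1 : Continuous fun q : (F.HolimSpace k × I) × I => q.1.1.1.2 s q.2 :=
        Continuous.eval (h0.comp (continuous_fst.comp continuous_fst)) continuous_snd
      have h2 : Continuous fun q : (F.HolimSpace k × I) × I =>
          (F.obj s).deloop k (q.1.1.1.2 s q.2) q.1.2 :=
        Continuous.eval (((F.obj s).deloop k).continuous.comp h1)
          (continuous_snd.comp continuous_fst)
      exact h2

/-- The homotopy limit `holim_s F^s` of a tower of `Ω`-spectra, formed levelwise. -/
def holim : Prespectrum.{u} where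
  space k := F.HolimSpace k
  pt k := F.holimBase k
  deloop k := F.holimDeloop k
  deloop_pt k := by
    refine Path.ext (funext fun v => Subtype.ext (Prod.ext (funext fun s => ?_)
      (funext fun s => ContinuousMap.ext fun w => ?_)))
    · exact congrArg (fun q => q v) ((F.obj s).deloop_pt k)
    · exact congrArg (fun q => q v) ((F.obj s).deloop_pt k)

/-- A filtered spectrum is complete if `holim_s F^s` is contractible. -/
def IsComplete : Prop := F.holim.IsContractible

/-! ### The spectral sequence of a filtered spectrum

The `E_1`-term is `π_* Gr^s F`.  With `i : π_* F^{s+1} → π_* F^s`, `j : π_* F^s → π_* Gr^s F` and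
`∂ : π_* Gr^s F → π_{*-1} F^{s+1}` the maps of the exact couple, an element `x` of
`π_{-k} Gr^s F` survives to `E_r` if and only if `∂ x` lifts to an element `w` of
`π_{-k-1} F^{s+r}`, and then `d_r [x] = [j w]`. -/

/-- `d_r [x] = [y]`, where `x ∈ π_{-k} Gr^s F` survives to `E_r` and `y ∈ π_{-k-1} Gr^{s+r} F`:
there is a lift `w` of `∂ x` along `F^{s+r} → F^{s+1}` with `y = j w`. -/
def IsDifferential (r : ℤ) (hr : 1 ≤ r) (s k : ℤ) (x : (F.gr s).homotopy k)
    (y : (F.gr (s + r)).homotopy (k + 1)) : Prop :=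
  ∃ w : (F.obj (s + r)).homotopy (k + 1),
    (F.map (add_le_add_right hr s)).onHomotopy (k + 1) w = (F.step s).boundary k x ∧
      (F.step (s + r)).toCofiber (k + 1) w = y

/-- The class of `y ∈ π_{-k} Gr^{s+r} F` is zero in `E_r`: it is the image under `j` of an element
of the kernel of `π_{-k} F^{s+r} → π_{-k} F^{s+1}`. -/
def IsZeroOnPage (r : ℤ) (hr : 1 ≤ r) (s k : ℤ) (y : (F.gr (s + r)).homotopy k) : Prop :=
  ∃ w : (F.obj (s + r)).homotopy k,
    (F.map (add_le_add_right hr s)).onHomotopy k w = (F.obj (s + 1)).zero k ∧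
      (F.step (s + r)).toCofiber k w = y

/-- All nonzero differentials `d_r`, `r ≥ 1`, in the spectral sequence of `F` go from even to odd
total degree (the source `x` has total degree `-k`, the target `y` has total degree `-(k+1)`). -/
def EvenToOdd : Prop :=
  ∀ (r : ℤ) (hr : 1 ≤ r) (s k : ℤ) (x : (F.gr s).homotopy k)
    (y : (F.gr (s + r)).homotopy (k + 1)),
    F.IsDifferential r hr s k x y → ¬ F.IsZeroOnPage r hr s (k + 1) y →
      Even (-k) ∧ Odd (-(k + 1))

end FilteredPrespectrum

/-! ### Bifiltered spectra -/

/-- A bifiltered spectrum `F^{s,t} A`, decreasing in both variables.  The indices may take the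
value `-∞`, and `A = F^{-∞,-∞} A`. -/
structure BifilteredSpectrum where
  obj : WithBot ℤ → WithBot ℤ → Prespectrum.{u}
  isSpectrum : ∀ s t, (obj s t).IsSpectrum
  map : ∀ {s s' t t' : WithBot ℤ}, s ≤ s' → t ≤ t' → (obj s' t').Hom (obj s t)
  map_refl : ∀ (s t : WithBot ℤ) k (x : (obj s t).space k),
    (map (le_refl s) (le_refl t)).app k x = x
  map_trans : ∀ {s s' s'' t t' t'' : WithBot ℤ} (hs : s ≤ s') (hs' : s' ≤ s'')
    (ht : t ≤ t') (ht' : t' ≤ t'') k (x : (obj s'' t'').space k),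
    (map hs ht).app k ((map hs' ht').app k x) = (map (hs.trans hs') (ht.trans ht')).app k x

namespace BifilteredSpectrum

variable (A : BifilteredSpectrum.{u})

/-- The horizontal filtration `s ↦ F^{s,t} A` of `F^{-∞,t} A`. -/
def horizontal (t : WithBot ℤ) : FilteredPrespectrum.{u} where
  obj s := A.obj s t
  map h := A.map (WithBot.coe_le_coe.mpr h) (le_refl t)
  map_refl s k x := A.map_refl s t k x
  map_trans _ _ k x := A.map_trans _ _ (le_refl t) (le_refl t) k x

/-- The vertical filtration `t ↦ F^{s,t} A` of `F^{s,-∞} A`. -/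
def vertical (s : WithBot ℤ) : FilteredPrespectrum.{u} where
  obj t := A.obj s t
  map h := A.map (le_refl s) (WithBot.coe_le_coe.mpr h)
  map_refl t k x := A.map_refl s t k x
  map_trans _ _ k x := A.map_trans (le_refl s) (le_refl s) _ _ k x

/-- The horizontal filtration `s ↦ F^{s,t} A / F^{s,t+1} A` of the vertical graded piece
`F^{-∞,t} A / F^{-∞,t+1} A`. -/
def verticalGr (t : ℤ) : FilteredPrespectrum.{u} where
  obj s := (A.vertical s).gr t
  map {a b} h := Prespectrum.Hom.cofiberMap _ _
    (A.map (WithBot.coe_le_coe.mpr h) (le_refl ((t + 1 : ℤ) : WithBot ℤ)))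
    (A.map (WithBot.coe_le_coe.mpr h) (le_refl (t : WithBot ℤ)))
    (fun k x => (A.map_trans _ _ _ _ k x).trans (A.map_trans _ _ _ _ k x).symm)
  map_refl s k z := by
    refine Subtype.ext (Prod.ext (A.map_refl _ _ _ _) (ContinuousMap.ext fun w => ?_))
    exact A.map_refl _ _ _ _
  map_trans h h' k z := by
    refine Subtype.ext (Prod.ext (A.map_trans _ _ _ _ _ _) (ContinuousMap.ext fun w => ?_))
    exact A.map_trans _ _ _ _ _ _

/-- The vertical filtration `t ↦ F^{s,t} A / F^{s+1,t} A` of the horizontal graded piece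
`F^{s,-∞} A / F^{s+1,-∞} A`. -/
def horizontalGr (s : ℤ) : FilteredPrespectrum.{u} where
  obj t := (A.horizontal t).gr s
  map {a b} h := Prespectrum.Hom.cofiberMap _ _
    (A.map (le_refl ((s + 1 : ℤ) : WithBot ℤ)) (WithBot.coe_le_coe.mpr h))
    (A.map (le_refl (s : WithBot ℤ)) (WithBot.coe_le_coe.mpr h))
    (fun k x => (A.map_trans _ _ _ _ k x).trans (A.map_trans _ _ _ _ k x).symm)
  map_refl s k z := by
    refine Subtype.ext (Prod.ext (A.map_refl _ _ _ _) (ContinuousMap.ext fun w => ?_))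
    exact A.map_refl _ _ _ _
  map_trans h h' k z := by
    refine Subtype.ext (Prod.ext (A.map_trans _ _ _ _ _ _) (ContinuousMap.ext fun w => ?_))
    exact A.map_trans _ _ _ _ _ _

/-- A sequence of spectra `F^s` (`s → -∞`) mapping compatibly to `B` exhibits `B` as its homotopy
colimit: `colim_s π_* F^s → π_* B` is bijective. -/
def IsHocolim (F : FilteredPrespectrum.{u}) (B : Prespectrum.{u}) (f : ∀ s, (F.obj s).Hom B) : Prop :=
  (∀ (k : ℤ) (b : B.homotopy k), ∃ (s : ℤ) (x : (F.obj s).homotopy k),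
    (f s).onHomotopy k x = b) ∧
  ∀ (k s : ℤ) (x x' : (F.obj s).homotopy k), (f s).onHomotopy k x = (f s).onHomotopy k x' →
    ∃ (s' : ℤ) (h : s' ≤ s), (F.map h).onHomotopy k x = (F.map h).onHomotopy k x'

/-- The filtrations are exhaustive: `F^{-∞,t} A = hocolim_s F^{s,t} A` and
`F^{s,-∞} A = hocolim_t F^{s,t} A`, also for `t = -∞` and `s = -∞`. -/
def IsExhaustive : Prop :=
  (∀ t : WithBot ℤ, IsHocolim (A.horizontal t) (A.obj ⊥ t) fun _ => A.map bot_le (le_refl t)) ∧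
  ∀ s : WithBot ℤ, IsHocolim (A.vertical s) (A.obj s ⊥) fun _ => A.map (le_refl s) bot_le

/-- The bifiltered spectrum is complete with respect to both filtrations:
`holim_s F^{s,t} A ≃ *` for all `t` and `holim_t F^{s,t} A ≃ *` for all `s`, also for `t = -∞`
and `s = -∞`. -/
def IsComplete : Prop :=
  (∀ t : WithBot ℤ, (A.horizontal t).IsComplete) ∧ ∀ s : WithBot ℤ, (A.vertical s).IsComplete

/-- Going clockwise around the square, i.e. in the spectral sequences
`π_* BiGr A ⇒ π_* Gr^v A` and `π_* Gr^v A ⇒ π_* A`, all nonzero differentials go from even to odd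
total degree. -/
def ClockwiseEvenToOdd : Prop :=
  (∀ t : ℤ, (A.verticalGr t).EvenToOdd) ∧ (A.vertical ⊥).EvenToOdd

/-- Going counterclockwise around the square, i.e. in the spectral sequences
`π_* BiGr A ⇒ π_* Gr^h A` and `π_* Gr^h A ⇒ π_* A`, all nonzero differentials go from even to odd
total degree. -/
def CounterclockwiseEvenToOdd : Prop :=
  (∀ s : ℤ, (A.horizontalGr s).EvenToOdd) ∧ (A.horizontal ⊥).EvenToOdd

end BifilteredSpectrum

end StableHomotopy

/-! The statement becomes symmetric once the parity condition is rephrased in terms of injectivity.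
A differential into even total degree starts from some `∂ x`, which lies in the kernel of `F^{s+1} →
F^s` on even homotopy. If these kernels vanish, every such differential is zero
(`evenToOdd_of_kernelTrivial`); this needs no convergence. Conversely, if those differentials vanish
and the inverse limits of the homotopy groups are trivial, an element of such a kernel lifts
arbitrarily far up the tower, and coherently so, hence is zero (`EvenToOdd.kernelTrivial_step`).

The hypotheses therefore say that, on even homotopy, `F^{s,t}/F^{s,t+1}` injects as `s` decreases
and `F^{-∞,t}` injects as `t` decreases. For the first of these, triviality of the limit of the
homotopy of the quotients comes from `lim` and `lim¹` of the two towers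
(`IsComplete.cofiber_eq_zero`).

The central step is that `F^{s,t} → F^{-∞,t}` is injective on even homotopy
(`kernelTrivial_map_bot`). A class dying in `F^{-∞,t}` already dies in some `F^{s',t}`, so its image
in `F^{s,t}/F^{s,t+1}` vanishes by injectivity, and it lifts to `F^{s,t+1}`. The lift again dies in
`F^{-∞,t+1}`, so lifting never stops, and completeness in `t` kills the class. Consequently all maps
between the `F^{s,t}` with finite indices are injective on even homotopy. Passing to the colimit in
`t` settles spectral sequence (4). For (3), a diagram chase in a square exchanges the two directions
of the iterated cofibre (`Hom.KernelTrivial.cofiberMap_flip`). -/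

namespace StableHomotopy

/-! ### Homotopy classes of paths -/

section PathClasses

variable {S T : Type u} [TopologicalSpace S] [TopologicalSpace T]

theorem pathClass_map_trans {a b c : S} (f : C(S, T)) (p : Path.Homotopic.Quotient a b)
    (q : Path.Homotopic.Quotient b c) : (p.trans q).map f = (p.map f).trans (q.map f) := by
  induction p using Path.Homotopic.Quotient.ind with | mk p =>
  induction q using Path.Homotopic.Quotient.ind with | mk q =>
  rw [← Path.Homotopic.Quotient.mk_trans, ← Path.Homotopic.Quotient.mk_map,
    ← Path.Homotopic.Quotient.mk_map, ← Path.Homotopic.Quotient.mk_map,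
    ← Path.Homotopic.Quotient.mk_trans, Path.map_trans]

theorem pathClass_map_symm {a b : S} (f : C(S, T)) (p : Path.Homotopic.Quotient a b) :
    p.symm.map f = (p.map f).symm := by
  induction p using Path.Homotopic.Quotient.ind with | mk p => rfl

theorem pathClass_map_refl (a : S) (f : C(S, T)) :
    (Path.Homotopic.Quotient.refl a).map f = Path.Homotopic.Quotient.refl (f a) := rfl

theorem joined_path_iff {a b : S} (p q : Path a b) : Joined p q ↔ p.Homotopic q := by
  constructor
  · rintro ⟨γ⟩
    exact ⟨{
      toFun := fun z => γ z.1 z.2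
      continuous_toFun := Path.continuous_uncurry_iff.mpr γ.continuous
      map_zero_left := fun t => by simp
      map_one_left := fun t => by simp
      prop' := fun t x hx => by
        rcases hx with rfl | rfl <;> simp }⟩
  · rintro ⟨H⟩
    exact ⟨{
      toFun := H.eval
      continuous_toFun := Path.continuous_uncurry_iff.mp H.continuous
      source' := H.eval_zero
      target' := H.eval_one }⟩

theorem zerothHomotopy_mk_eq_iff {x y : S} :
    ZerothHomotopy.mk x = ZerothHomotopy.mk y ↔ Joined x y :=
  Quotient.eq (r := pathSetoid S)

theorem mapComponents_mk (f : C(S, T)) (x : S) :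
    mapComponents f (ZerothHomotopy.mk x) = ZerothHomotopy.mk (f x) := rfl

/-- The boundary of a square of paths commutes up to homotopy. -/
theorem pathClass_of_square {a b c d : T} (H : C(I × I, T)) (p : Path a b) (q : Path c d)
    (u : Path a c) (v : Path b d) (hp : ∀ t, H (0, t) = p t) (hq : ∀ t, H (1, t) = q t)
    (hu : ∀ t, H (t, 0) = u t) (hv : ∀ t, H (t, 1) = v t) :
    (Path.Homotopic.Quotient.mk p).trans (Path.Homotopic.Quotient.mk v) =
      (Path.Homotopic.Quotient.mk u).trans (Path.Homotopic.Quotient.mk q) := by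
  -- The two ways around the boundary of `I × I` are homotopic because the square is simply
  -- connected; `H` carries that homotopy to `T`.
  have : ContractibleSpace I := Convex.contractibleSpace (convex_Icc _ _) ⟨0, by simp⟩
  obtain rfl : H (0, 0) = a := by simp [hp]
  obtain rfl : H (0, 1) = b := by simp [hp]
  obtain rfl : H (1, 0) = c := by simp [hq]
  obtain rfl : H (1, 1) = d := by simp [hq]
  let idp : Path (0 : I) 1 := ⟨ContinuousMap.id I, rfl, rfl⟩
  let p' : Path ((0, 0) : I × I) (0, 1) := (Path.refl 0).prod idp
  let q' : Path ((1, 0) : I × I) (1, 1) := (Path.refl 1).prod idp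
  let u' : Path ((0, 0) : I × I) (1, 0) := idp.prod (Path.refl 0)
  let v' : Path ((0, 1) : I × I) (1, 1) := idp.prod (Path.refl 1)
  obtain rfl : p = p'.map H.continuous := Path.ext (funext fun t => (hp t).symm)
  obtain rfl : q = q'.map H.continuous := Path.ext (funext fun t => (hq t).symm)
  obtain rfl : u = u'.map H.continuous := Path.ext (funext fun t => (hu t).symm)
  obtain rfl : v = v'.map H.continuous := Path.ext (funext fun t => (hv t).symm)
  rw [← Path.Homotopic.Quotient.mk_trans, ← Path.Homotopic.Quotient.mk_trans,
    ← Path.map_trans, ← Path.map_trans]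
  exact Path.Homotopic.Quotient.eq.mpr ((SimplyConnectedSpace.paths_homotopic _ _).map H)

end PathClasses

/-! ### Path components of homotopy fibres -/

namespace HoFiber

variable {S T : Type u} [TopologicalSpace S] [TopologicalSpace T]

/-- The path in `T` underlying a point of a homotopy fibre. -/
def path {f : C(S, T)} {y₀ : T} (z : HoFiber f y₀) : Path (f z.1.1) y₀ := ⟨z.1.2, z.2.1, z.2.2⟩

/-- The point of a homotopy fibre given by a path. -/
def ofPath (f : C(S, T)) {y₀ : T} (x : S) (p : Path (f x) y₀) : HoFiber f y₀ :=
  ⟨(x, p.toContinuousMap), p.source, p.target⟩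

theorem joined_ofPath_of_homotopic (f : C(S, T)) {y₀ : T} (x : S) {p q : Path (f x) y₀}
    (h : p.Homotopic q) : Joined (ofPath f x p) (ofPath f x q) := by
  obtain ⟨γ⟩ := (joined_path_iff p q).mpr h
  exact ⟨{
    toFun := fun v => ofPath f x (γ v)
    continuous_toFun := by
      refine Continuous.subtype_mk (Continuous.prodMk continuous_const ?_) _
      exact continuous_induced_dom.comp γ.continuous
    source' := by simp
    target' := by simp }⟩

/-- The point slides along `q` while the part of the path already traversed is cut off. -/
theorem joined_ofPath_trans (f : C(S, T)) {y₀ : T} {x x' : S} (q : Path x x')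
    (p : Path (f x') y₀) :
    Joined (ofPath f x ((q.map f.continuous).trans p)) (ofPath f x' p) := by
  let r := (q.map f.continuous).trans p
  -- At time `v` the remaining path is `r` on `[v/2, 1]`, and `c (v, ·)` parametrises this interval
  -- affinely. The first half of `r` is `f ∘ q`, so the remaining path starts at `f (q v)`.
  let c : I × I → I := fun z => ⟨(z.1 : ℝ) / 2 + z.2 * (1 - z.1 / 2), by
    have h1 := z.1.2.1; have h2 := z.1.2.2; have h3 := z.2.2.1; have h4 := z.2.2.2
    constructor
    · nlinarith
    · nlinarith⟩
  have hc : Continuous c := by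
    refine Continuous.subtype_mk ?_ _
    fun_prop
  have hr : ∀ v : I, r (c (v, 0)) = f (q v) := fun v => by
    have : ((c (v, 0) : I) : ℝ) = v / 2 := by simp [c]
    have h2 := v.2.2
    simp only [r, Path.trans_apply]
    rw [dif_pos (by rw [this]; linarith)]
    simp only [Path.map_coe, Function.comp_apply]
    congr 2
    ext
    simp [this]
    ring
  have hr1 : ∀ w : I, r (c (1, w)) = p w := fun w => by
    have h1 := w.2.1
    have hw : ((c (1, w) : I) : ℝ) = 1 / 2 + w / 2 := by simp [c]; ring
    by_cases h0 : (w : ℝ) = 0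
    · have hw0 : w = 0 := Subtype.ext h0
      rw [hw0, hr]; simp
    · simp only [r, Path.trans_apply]
      rw [dif_neg (by rw [hw]; intro h; apply h0; linarith)]
      congr 1
      ext
      simp [hw]
      ring
  refine ⟨{
    toFun := fun v => ⟨(q v, ⟨fun w => r (c (v, w)), by fun_prop⟩), hr v, ?_⟩
    continuous_toFun := ?_
    source' := ?_
    target' := ?_ }⟩
  · have : c (v, 1) = 1 := by ext; simp [c]
    show r (c (v, 1)) = y₀
    rw [this]; simp
  · refine Continuous.subtype_mk (Continuous.prodMk q.continuous ?_) _
    refine ContinuousMap.continuous_of_continuous_uncurry _ ?_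
    exact r.continuous.comp hc
  · refine Subtype.ext (Prod.ext q.source (ContinuousMap.ext fun w => ?_))
    show r (c (0, w)) = r w
    congr 1; ext; simp [c]
  · exact Subtype.ext (Prod.ext q.target (ContinuousMap.ext fun w => hr1 w))

/-- Two points of a homotopy fibre are joined by a path if and only if there is a path between
their projections compatible with the paths to the base point. -/
theorem joined_iff {f : C(S, T)} {y₀ : T} (z z' : HoFiber f y₀) :
    Joined z z' ↔ ∃ q : Path.Homotopic.Quotient z.1.1 z'.1.1,
      Path.Homotopic.Quotient.mk z.path = (q.map f).trans (Path.Homotopic.Quotient.mk z'.path) := by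
  constructor
  · rintro ⟨γ⟩
    let q : Path z.1.1 z'.1.1 := γ.map (continuous_fst.comp continuous_subtype_val)
    refine ⟨Path.Homotopic.Quotient.mk q, ?_⟩
    have h1 : Continuous fun a : I × I => (γ a.1).1.2 a.2 :=
      Continuous.eval (continuous_snd.comp (continuous_subtype_val.comp
        (γ.continuous.comp continuous_fst))) continuous_snd
    have := pathClass_of_square ⟨_, h1⟩ z.path z'.path (q.map f.continuous) (Path.refl y₀)
      (fun t => by simp [path]) (fun t => by simp [path]) (fun t => (γ t).2.1)
      (fun t => (γ t).2.2)
    rw [Path.Homotopic.Quotient.mk_refl, Path.Homotopic.Quotient.trans_refl] at this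
    exact this
  · rintro ⟨q, hq⟩
    induction q using Path.Homotopic.Quotient.ind with | mk q =>
    rw [← Path.Homotopic.Quotient.mk_map, ← Path.Homotopic.Quotient.mk_trans,
      Path.Homotopic.Quotient.eq] at hq
    exact (joined_ofPath_of_homotopic f z.1.1 hq).trans (joined_ofPath_trans f q z'.path)

end HoFiber

/-! ### Weak equivalences on fundamental groupoids -/

section PathClasses

variable {S T : Type u} [TopologicalSpace S] [TopologicalSpace T]

theorem pathClass_cast_trans {a b c a' b' c' : S} (p : Path.Homotopic.Quotient a b)
    (q : Path.Homotopic.Quotient b c) (ha : a' = a) (hb : b' = b) (hc : c' = c) :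
    (p.cast ha hb).trans (q.cast hb hc) = (p.trans q).cast ha hc := by
  subst ha hb hc; simp

theorem pathClass_cast_injective {a b a' b' : S} (ha : a' = a) (hb : b' = b) :
    Function.Injective fun p : Path.Homotopic.Quotient a b => p.cast ha hb := by
  subst ha hb; intro p q h; simpa using h

theorem pathClass_map_congr {f g : C(S, T)} (h : ∀ x, f x = g x) {a b : S}
    (p : Path.Homotopic.Quotient a b) : p.map f = (p.map g).cast (h a) (h b) := by
  obtain rfl : f = g := ContinuousMap.ext h
  simp

theorem IsWeakHomotopyEquiv.joined_of_joined {f : C(S, T)} (hf : IsWeakHomotopyEquiv f) {x y : S}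
    (h : Joined (f x) (f y)) : Joined x y :=
  zerothHomotopy_mk_eq_iff.mp (hf.1.1 (zerothHomotopy_mk_eq_iff.mpr h))

theorem exists_joined_of_surjective_mapComponents {f : C(S, T)}
    (hf : Function.Surjective (mapComponents f)) (y : T) : ∃ x, Joined (f x) y := by
  obtain ⟨x, hx⟩ := hf (ZerothHomotopy.mk y)
  induction x using ZerothHomotopy.rec with | mk x =>
  exact ⟨x, zerothHomotopy_mk_eq_iff.mp hx⟩

theorem IsWeakHomotopyEquiv.loopClass_bijective {f : C(S, T)} (hf : IsWeakHomotopyEquiv f)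
    (x : S) : Function.Bijective fun q : Path.Homotopic.Quotient x x => q.map f := by
  have h1 := hf.2 1 x le_rfl
  have h2 : (fun q : Path.Homotopic.Quotient x x => q.map f) ∘
      (HomotopyGroup.pi1EquivFundamentalGroup (x := x)) =
      (HomotopyGroup.pi1EquivFundamentalGroup (x := f x)) ∘ mapHomotopyGroup f 1 x := by
    funext a
    induction a using Quotient.ind with | _ a => rfl
  have h3 := (HomotopyGroup.pi1EquivFundamentalGroup (x := f x)).bijective.comp h1
  rw [← h2] at h3
  exact (Function.Bijective.of_comp_iff _ (Equiv.bijective _)).mp h3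

/-- A weak homotopy equivalence is fully faithful on fundamental groupoids. -/
theorem IsWeakHomotopyEquiv.pathClass_bijective {f : C(S, T)} (hf : IsWeakHomotopyEquiv f)
    (x y : S) : Function.Bijective fun q : Path.Homotopic.Quotient x y => q.map f := by
  constructor
  · intro q q' h
    have h1 : (q.trans q'.symm).map f = (Path.Homotopic.Quotient.refl x).map f := by
      simp only at h
      rw [pathClass_map_trans, pathClass_map_symm, h, Path.Homotopic.Quotient.trans_symm,
        pathClass_map_refl]
    have h2 := (hf.loopClass_bijective x).1 h1
    calc q = (q.trans q'.symm).trans q' := by simp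
      _ = q' := by rw [h2]; simp
  · intro p
    obtain ⟨p₀, rfl⟩ := Path.Homotopic.Quotient.mk_surjective p
    -- Injectivity on components supplies some path `r` from `x` to `y`; its image differs from `p₀`
    -- by a loop, which lifts by bijectivity on loops at `x`.
    obtain ⟨r⟩ := hf.joined_of_joined ⟨p₀⟩
    obtain ⟨l, hl⟩ := (hf.loopClass_bijective x).2
      ((Path.Homotopic.Quotient.mk p₀).trans ((Path.Homotopic.Quotient.mk r).map f).symm)
    refine ⟨l.trans (Path.Homotopic.Quotient.mk r), ?_⟩
    simp only at hl ⊢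
    rw [pathClass_map_trans, hl]
    simp

end PathClasses

/-! ### Loops in a homotopy fibre -/

namespace HoFiber

variable {S T S' T' : Type u} [TopologicalSpace S] [TopologicalSpace T] [TopologicalSpace S']
  [TopologicalSpace T']

/-- The map of loop spaces induced by a pointed map. -/
def mapLoop (f : C(S, T)) {x₀ : S} {y₀ : T} (h : f x₀ = y₀) : C(Path x₀ x₀, Path y₀ y₀) where
  toFun p := (p.map f.continuous).cast h.symm h.symm
  continuous_toFun := by
    refine Path.continuous_uncurry_iff.mp ?_
    have : Continuous fun a : Path x₀ x₀ × I => f (a.1 a.2) := by fun_prop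
    exact this

/-- A loop in the homotopy fibre is a point of the homotopy fibre of the map of loop spaces. -/
def ofLoop {f : C(S, T)} {x₀ : S} {y₀ : T} (h : f x₀ = y₀) :
    C(Path (base h) (base h), HoFiber (mapLoop f h) (Path.refl y₀)) where
  toFun L := ofPath (mapLoop f h)
    { toFun := fun v => (L v).1.1
      continuous_toFun := continuous_fst.comp (continuous_subtype_val.comp L.continuous)
      source' := congrArg (fun z => z.1.1) L.source
      target' := congrArg (fun z => z.1.1) L.target }
    { toFun := fun w =>
        { toFun := fun v => (L v).1.2 w
          continuous_toFun := (continuous_eval_const w).comp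
            (continuous_snd.comp (continuous_subtype_val.comp L.continuous))
          source' := congrArg (fun z => z.1.2 w) L.source
          target' := congrArg (fun z => z.1.2 w) L.target }
      continuous_toFun := by
        refine Path.continuous_uncurry_iff.mp ?_
        have : Continuous fun a : I × I => (L a.2).1.2 a.1 :=
          Continuous.eval (continuous_snd.comp (continuous_subtype_val.comp
            (L.continuous.comp continuous_snd))) continuous_fst
        exact this
      source' := Path.ext (funext fun v => (L v).2.1)
      target' := Path.ext (funext fun v => (L v).2.2) }
  continuous_toFun := by
    refine Continuous.subtype_mk (Continuous.prodMk ?_ ?_) _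
    · refine Path.continuous_uncurry_iff.mp ?_
      have : Continuous fun a : Path (base h) (base h) × I => (a.1 a.2).1.1 :=
        continuous_fst.comp (continuous_subtype_val.comp (continuous_fst.eval continuous_snd))
      exact this
    · refine ContinuousMap.continuous_of_continuous_uncurry _ ?_
      refine Path.continuous_uncurry_iff.mp ?_
      have h1 : Continuous fun a : (Path (base h) (base h) × I) × I => a.1.1 a.2 :=
        (continuous_fst.comp continuous_fst).eval continuous_snd
      have : Continuous fun a : (Path (base h) (base h) × I) × I => (a.1.1 a.2).1.2 a.1.2 :=
        Continuous.eval (continuous_snd.comp (continuous_subtype_val.comp h1)) (by fun_prop)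
      exact this

/-- A point of the homotopy fibre of the map of loop spaces is a loop in the homotopy fibre. -/
def toLoop {f : C(S, T)} {x₀ : S} {y₀ : T} (h : f x₀ = y₀) :
    C(HoFiber (mapLoop f h) (Path.refl y₀), Path (base h) (base h)) where
  toFun z :=
    { toFun := fun v => ⟨(z.1.1 v, ⟨fun w => z.1.2 w v, by fun_prop⟩),
        congrArg (fun p : Path y₀ y₀ => p v) z.2.1, congrArg (fun p : Path y₀ y₀ => p v) z.2.2⟩
      continuous_toFun := by
        refine Continuous.subtype_mk (Continuous.prodMk (by fun_prop) ?_) _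
        refine ContinuousMap.continuous_of_continuous_uncurry _ ?_
        have : Continuous fun a : I × I => z.1.2 a.2 a.1 := by fun_prop
        exact this
      source' := Subtype.ext (Prod.ext z.1.1.source
        (ContinuousMap.ext fun w => (z.1.2 w).source))
      target' := Subtype.ext (Prod.ext z.1.1.target
        (ContinuousMap.ext fun w => (z.1.2 w).target)) }
  continuous_toFun := by
    refine Path.continuous_uncurry_iff.mp ?_
    refine Continuous.subtype_mk (Continuous.prodMk ?_ ?_) _
    · have : Continuous fun a : HoFiber (mapLoop f h) (Path.refl y₀) × I => a.1.1.1 a.2 :=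
        Continuous.eval (continuous_fst.comp (continuous_subtype_val.comp continuous_fst))
          continuous_snd
      exact this
    · refine ContinuousMap.continuous_of_continuous_uncurry _ ?_
      have h1 : Continuous fun a : (HoFiber (mapLoop f h) (Path.refl y₀) × I) × I =>
          a.1.1.1.2 a.2 :=
        Continuous.eval (continuous_snd.comp (continuous_subtype_val.comp
          (continuous_fst.comp continuous_fst))) continuous_snd
      have : Continuous fun a : (HoFiber (mapLoop f h) (Path.refl y₀) × I) × I =>
          a.1.1.1.2 a.2 a.1.2 :=
        Continuous.eval h1 (by fun_prop)
      exact this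

/-- This is the exponential law: a loop of pairs (point, path) is a loop together with a path of
loops. The composite of `ofLoop` followed by `toLoop` is the identity by definition, so both
directions are transport along a continuous map. -/
theorem joined_loop_iff {f : C(S, T)} {x₀ : S} {y₀ : T} (h : f x₀ = y₀)
    (L L' : Path (base h) (base h)) : Joined L L' ↔ Joined (ofLoop h L) (ofLoop h L') :=
  ⟨fun H => H.map (ofLoop h).continuous, fun H => H.map (toLoop h).continuous⟩

theorem mk_path_ofLoop_loopMap (f : C(S, T)) (f' : C(S', T')) (t₀ : T) {x₀ : S'} {y₀ : T'}
    (h : f' x₀ = y₀) (e : C(S, Path x₀ x₀)) (e' : C(T, Path y₀ y₀)) (ht₀ : e' t₀ = Path.refl y₀)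
    (comm : ∀ x v, e' (f x) v = f' (e x v)) (hc : ∀ x, mapLoop f' h (e x) = e' (f x))
    (z : HoFiber f t₀) :
    Path.Homotopic.Quotient.mk (ofLoop h (loopMap f f' t₀ h e e' ht₀ comm z)).path =
      ((Path.Homotopic.Quotient.mk z.path).map e').cast (hc z.1.1) ht₀.symm := rfl

/-- The map from the homotopy fibre of `f` to the loop space of the homotopy fibre of `f'` induced
by weak homotopy equivalences `S → Ω S'` and `T → Ω T'` is bijective on path components. -/
theorem bijective_mapComponents_loopMap (f : C(S, T)) (f' : C(S', T')) (t₀ : T) {x₀ : S'}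
    {y₀ : T'} (h : f' x₀ = y₀) (e : C(S, Path x₀ x₀)) (e' : C(T, Path y₀ y₀))
    (ht₀ : e' t₀ = Path.refl y₀) (comm : ∀ x v, e' (f x) v = f' (e x v))
    (he : IsWeakHomotopyEquiv e) (he' : IsWeakHomotopyEquiv e') :
    Function.Bijective (mapComponents (loopMap f f' t₀ h e e' ht₀ comm)) := by
  have hc : ∀ x, mapLoop f' h (e x) = e' (f x) := fun x =>
    Path.ext (funext fun v => (comm x v).symm)
  constructor
  · intro a b hab
    induction a using ZerothHomotopy.rec with | mk z =>
    induction b using ZerothHomotopy.rec with | mk z' =>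
    rw [mapComponents_mk, mapComponents_mk, zerothHomotopy_mk_eq_iff, joined_loop_iff,
      joined_iff] at hab
    obtain ⟨q, hq⟩ := hab
    -- Fullness of `e` lifts the connecting path to `S`; faithfulness of `e'` then lets the
    -- compatibility be checked after applying `e'`.
    obtain ⟨r, hr⟩ := (he.pathClass_bijective z.1.1 z'.1.1).2 q
    rw [zerothHomotopy_mk_eq_iff, joined_iff]
    refine ⟨r, (he'.pathClass_bijective _ _).1 ?_⟩
    refine pathClass_cast_injective (hc z.1.1) ht₀.symm ?_
    rw [mk_path_ofLoop_loopMap _ _ _ _ _ _ _ _ hc, mk_path_ofLoop_loopMap _ _ _ _ _ _ _ _ hc]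
      at hq
    have hr' : q.map (mapLoop f' h) = ((r.map f).map e').cast (hc _) (hc _) := by
      have h1 := pathClass_map_congr (f := (mapLoop f' h).comp e) (g := e'.comp f) hc r
      rw [Path.Homotopic.Quotient.map_comp, Path.Homotopic.Quotient.map_comp] at h1
      rw [← hr]
      exact h1
    simp only [pathClass_map_trans]
    rw [← pathClass_cast_trans _ _ _ (hc _), ← hr']
    exact hq
  · intro b
    induction b using ZerothHomotopy.rec with | mk L =>
    obtain ⟨x, ⟨q⟩⟩ := exists_joined_of_surjective_mapComponents he.1.2 (ofLoop h L).1.1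
    obtain ⟨r, hr⟩ := (he'.pathClass_bijective (f x) t₀).2
      ((((Path.Homotopic.Quotient.mk q).map (mapLoop f' h)).trans
        (Path.Homotopic.Quotient.mk (ofLoop h L).path)).cast (hc x).symm ht₀)
    obtain ⟨p, rfl⟩ := Path.Homotopic.Quotient.mk_surjective r
    refine ⟨ZerothHomotopy.mk (ofPath f x p), ?_⟩
    rw [mapComponents_mk, zerothHomotopy_mk_eq_iff, joined_loop_iff, joined_iff]
    refine ⟨Path.Homotopic.Quotient.mk q, ?_⟩
    rw [mk_path_ofLoop_loopMap _ _ _ _ _ _ _ _ hc]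
    simp only at hr
    have h1 : (Path.Homotopic.Quotient.mk (ofPath f x p).path).map e' = _ := hr
    rw [h1]
    exact (Path.Homotopic.Quotient.cast_cast _ _ _ _ _).trans
      (Path.Homotopic.Quotient.cast_rfl_rfl _)

end HoFiber

/-! ### Towers of sets and groups -/

section Towers

/-- If a tower has trivial inverse limit, then every element belonging to a family of elements that
can be lifted indefinitely within the family is trivial. -/
theorem eq_of_liftable {G : ℤ → Type u} (φ : ∀ {a b : ℤ}, a ≤ b → G b → G a)
    (hrefl : ∀ (a : ℤ) (x : G a), φ (le_refl a) x = x)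
    (htrans : ∀ {a b c : ℤ} (h : a ≤ b) (h' : b ≤ c) (x : G c), φ h (φ h' x) = φ (h.trans h') x)
    (z : ∀ s, G s)
    (hlim : ∀ a : ∀ s, G s, (∀ s, φ (le_of_lt (lt_add_one s)) (a (s + 1)) = a s) →
      ∀ s, a s = z s)
    (P : ∀ s, G s → Prop)
    (hP : ∀ s a, P s a → ∃ a', P (s + 1) a' ∧ φ (le_of_lt (lt_add_one s)) a' = a)
    {s : ℤ} {a : G s} (ha : P s a) : a = z s := by
  -- The index `t` is kept separate from `s + 1` because `s + ((n + 1 : ℕ) : ℤ)` and `s + n + 1` are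
  -- not definitionally equal.
  have hP' : ∀ s t (h : s ≤ t), t = s + 1 → ∀ a, P s a → ∃ a', P t a' ∧ φ h a' = a := by
    rintro s _ h rfl a ha
    exact hP s a ha
  have h0 : ∀ t, t = s → ∃ b : G t, P t b ∧ ∀ h : s ≤ t, φ h b = a := by
    rintro _ rfl
    exact ⟨a, ha, fun _ => hrefl _ a⟩
  have hle : ∀ n : ℕ, s + (n : ℤ) ≤ s + ((n + 1 : ℕ) : ℤ) := fun n => by push_cast; omega
  obtain ⟨b, hb, hba⟩ := h0 (s + ((0 : ℕ) : ℤ)) (by simp)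
  choose f hf hfa using fun n : ℕ =>
    hP' (s + (n : ℤ)) (s + ((n + 1 : ℕ) : ℤ)) (hle n) (by push_cast; ring)
  let seq : ∀ n : ℕ, {x : G (s + (n : ℤ)) // P _ x} := fun n =>
    Nat.rec ⟨b, hb⟩ (fun n x => ⟨f n x.1 x.2, hf n x.1 x.2⟩) n
  have hsucc : ∀ n, φ (hle n) (seq (n + 1)).1 = (seq n).1 := fun n => hfa n _ (seq n).2
  have hmono : ∀ (m n : ℕ) (_ : m ≤ n) (h : s + (m : ℤ) ≤ s + (n : ℤ)),
      φ h (seq n).1 = (seq m).1 := by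
    intro m n hmn
    induction n, hmn using Nat.le_induction with
    | base => exact fun _ => hrefl _ _
    | succ n hmn ih =>
      intro h
      have h1 : s + (m : ℤ) ≤ s + (n : ℤ) := by omega
      rw [← ih h1, ← hsucc n, htrans]
  have hself : ∀ t : ℤ, t ≤ s + ((t - s).toNat : ℤ) := fun t => by
    have := Int.self_le_toNat (t - s); omega
  -- The coherent sequence lives only at stages `≥ s`; smaller indices, where `toNat` truncates to
  -- `0`, receive the images of its first term.
  let fam : ∀ t, G t := fun t => φ (hself t) (seq (t - s).toNat).1
  have hfam : ∀ t (n : ℕ) (h : t ≤ s + (n : ℤ)), φ h (seq n).1 = fam t := by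
    intro t n h
    have h1 : (t - s).toNat ≤ n := by omega
    have h2 : s + ((t - s).toNat : ℤ) ≤ s + (n : ℤ) := by omega
    simp only [fam]
    rw [← hmono _ _ h1 h2, htrans]
  have hlim' := hlim fam (fun t => by simp only [fam]; rw [htrans]; exact hfam t _ _) s
  rw [← hlim', ← hfam s 0 (by simp)]
  exact (hba _).symm

/-- The algebra of a complete filtration in which the differentials into the given degree vanish:
the maps of the tower are injective. -/
theorem eq_one_of_map_eq_one {G : ℤ → Type u} [∀ s, Group (G s)]
    (φ : ∀ {a b : ℤ}, a ≤ b → G b →* G a)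
    (hrefl : ∀ (a : ℤ) (x : G a), φ (le_refl a) x = x)
    (htrans : ∀ {a b c : ℤ} (h : a ≤ b) (h' : b ≤ c) (x : G c), φ h (φ h' x) = φ (h.trans h') x)
    (hlim : ∀ a : ∀ s, G s, (∀ s, φ (le_of_lt (lt_add_one s)) (a (s + 1)) = a s) →
      ∀ s, a s = 1)
    (hdiff : ∀ (r : ℤ) (hr : 1 ≤ r) (s : ℤ) (w : G (s + r)),
      φ (le_of_lt (lt_add_one s)) (φ (add_le_add_right hr s) w) = 1 →
      ∃ (w' : G (s + r)) (v : G (s + r + 1)), φ (add_le_add_right hr s) w' = 1 ∧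
        w = w' * φ (le_of_lt (lt_add_one (s + r))) v)
    (s : ℤ) (a : G (s + 1)) (ha : φ (le_of_lt (lt_add_one s)) a = 1) : a = 1 := by
  have hker : ∀ s (a : G (s + 1)), φ (le_of_lt (lt_add_one s)) a = 1 →
      ∀ t (h : s + 1 ≤ t), ∃ b, φ h b = a := by
    intro s a ha
    have key : ∀ r (hr : 1 ≤ r), ∃ w, φ (add_le_add_right hr s) w = a := by
      intro r hr
      induction r, hr using Int.leInduction with
      | base => exact ⟨a, hrefl _ a⟩
      | succ r hr ih =>
        obtain ⟨w, hw⟩ := ih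
        -- The factor `w'` dies in `G (s + 1)`, so dropping it from the lift `w` leaves an element
        -- that still lifts `a` and comes from one stage higher.
        obtain ⟨w', v, hw', hv⟩ := hdiff r hr s w (by rw [hw, ha])
        have h1 : ∀ t, t = s + r + 1 → ∀ h : s + 1 ≤ t, ∃ v', φ h v' = a := by
          rintro _ rfl h
          refine ⟨v, ?_⟩
          rw [← hw, hv, map_mul, hw', one_mul, htrans]
        exact h1 _ (by ring) _
    intro t h
    obtain ⟨r, rfl⟩ : ∃ r, t = s + r := ⟨t - s, by ring⟩
    exact key r (by omega)
  -- Lifts to each stage separately need not be compatible. The property of lifting to every stage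
  -- is nevertheless inherited by any one-step lift `a'`: it differs from the image of a far lift by
  -- a kernel element, which by `hker` also lifts arbitrarily far.
  refine eq_of_liftable (fun h => φ h) hrefl htrans (fun _ => 1) hlim
    (fun s a => ∀ t (h : s ≤ t), ∃ b, φ h b = a) ?_ (hker s a ha)
  intro s a hQ
  obtain ⟨a', rfl⟩ := hQ (s + 1) (le_of_lt (lt_add_one s))
  refine ⟨a', fun t h => ?_, rfl⟩
  obtain ⟨b, hb⟩ := hQ t ((le_of_lt (lt_add_one s)).trans h)
  obtain ⟨d, hd⟩ := hker s (a' * (φ h b)⁻¹)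
    (by rw [map_mul, map_inv, htrans, hb, mul_inv_cancel]) t h
  exact ⟨d * b, by rw [map_mul, hd]; simp⟩

end Towers

/-! ### Homotopy groups as groups of loops -/

/-- The map sending a class in `π_{-k} X` to the class of the corresponding loop in the next space
of `X`. -/
def Prespectrum.toLoops (X : Prespectrum.{u}) (k : ℤ) :
    X.homotopy k → FundamentalGroup (X.space (k + 1)) (X.pt (k + 1)) :=
  ZerothHomotopy.lift (fun x => Path.Homotopic.Quotient.mk (X.deloop k x)) fun _ _ p =>
    Path.Homotopic.Quotient.eq.mpr ((joined_path_iff _ _).mp ⟨p.map (X.deloop k).continuous⟩)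

theorem Prespectrum.toLoops_zero (X : Prespectrum.{u}) (k : ℤ) : X.toLoops k (X.zero k) = 1 :=
  congrArg Path.Homotopic.Quotient.mk (X.deloop_pt k)

/-- A prespectrum whose structure maps are bijective on path components. -/
def Prespectrum.IsPiZeroSpectrum (X : Prespectrum.{u}) : Prop :=
  ∀ k, Function.Bijective (mapComponents (X.deloop k))

theorem Prespectrum.IsSpectrum.isPiZeroSpectrum {X : Prespectrum.{u}} (hX : X.IsSpectrum) :
    X.IsPiZeroSpectrum := fun k => (hX k).1

theorem Prespectrum.IsPiZeroSpectrum.toLoops_bijective {X : Prespectrum.{u}}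
    (hX : X.IsPiZeroSpectrum) (k : ℤ) : Function.Bijective (X.toLoops k) := by
  constructor
  · intro a b hab
    induction a using ZerothHomotopy.rec with | mk x =>
    induction b using ZerothHomotopy.rec with | mk y =>
    refine (hX k).1 ?_
    rw [mapComponents_mk, mapComponents_mk, zerothHomotopy_mk_eq_iff, joined_path_iff]
    exact Path.Homotopic.Quotient.eq.mp hab
  · intro p
    obtain ⟨p, rfl⟩ := Path.Homotopic.Quotient.mk_surjective p
    obtain ⟨x, hx⟩ := exists_joined_of_surjective_mapComponents (hX k).2 p
    exact ⟨ZerothHomotopy.mk x, Path.Homotopic.Quotient.eq.mpr ((joined_path_iff _ _).mp hx)⟩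

/-- The map on loops induced by a map of spectra. -/
noncomputable def Prespectrum.Hom.onLoops {X Y : Prespectrum.{u}} (f : X.Hom Y) (k : ℤ) :
    FundamentalGroup (X.space k) (X.pt k) →* FundamentalGroup (Y.space k) (Y.pt k) :=
  FundamentalGroup.mapOfEq (f.app k) (f.app_pt k)

theorem Prespectrum.Hom.onLoops_mk {X Y : Prespectrum.{u}} (f : X.Hom Y) (k : ℤ)
    (p : Path (X.pt k) (X.pt k)) :
    f.onLoops k (Path.Homotopic.Quotient.mk p) = Path.Homotopic.Quotient.mk
      ((p.map (f.app k).continuous).cast (f.app_pt k).symm (f.app_pt k).symm) :=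
  FundamentalGroup.mapOfEq_apply _ _ _

theorem Prespectrum.Hom.toLoops_onHomotopy {X Y : Prespectrum.{u}} (f : X.Hom Y) (k : ℤ)
    (x : X.homotopy k) :
    Y.toLoops k (f.onHomotopy k x) = f.onLoops (k + 1) (X.toLoops k x) := by
  induction x using ZerothHomotopy.rec with | mk x =>
  refine Eq.trans ?_ (f.onLoops_mk (k + 1) (X.deloop k x)).symm
  exact congrArg Path.Homotopic.Quotient.mk (Path.ext (funext fun v => f.comm k x v))

theorem Prespectrum.Hom.onHomotopy_zero {X Y : Prespectrum.{u}} (f : X.Hom Y) (k : ℤ) :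
    f.onHomotopy k (X.zero k) = Y.zero k :=
  congrArg ZerothHomotopy.mk (f.app_pt k)

theorem Prespectrum.Hom.onHomotopy_onHomotopy {X Y Z : Prespectrum.{u}} (f : X.Hom Y)
    (g : Y.Hom Z) (h : X.Hom Z) (k : ℤ) (H : ∀ x, g.app k (f.app k x) = h.app k x)
    (x : X.homotopy k) : g.onHomotopy k (f.onHomotopy k x) = h.onHomotopy k x := by
  induction x using ZerothHomotopy.rec with | mk x =>
  exact congrArg ZerothHomotopy.mk (H x)

/-- The group structure on the homotopy of a spectrum, transported from groups of loops. -/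
@[reducible] noncomputable def Prespectrum.IsPiZeroSpectrum.group {X : Prespectrum.{u}}
    (hX : X.IsPiZeroSpectrum) (k : ℤ) : Group (X.homotopy k) :=
  (Equiv.ofBijective _ (hX.toLoops_bijective k)).group

/-! ### The exact sequence of a homotopy cofibre -/

namespace HoFiber

variable {S T : Type u} [TopologicalSpace S] [TopologicalSpace T]

theorem joined_ofPath_loop_iff (f : C(S, T)) {x₀ : S} {y₀ : T} (h : f x₀ = y₀)
    (l l' : Path y₀ y₀) :
    Joined (ofPath f x₀ (l.cast h rfl)) (ofPath f x₀ (l'.cast h rfl)) ↔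
      ∃ g : FundamentalGroup S x₀, FundamentalGroup.fromPath (Path.Homotopic.Quotient.mk l) =
        FundamentalGroup.fromPath (Path.Homotopic.Quotient.mk l') *
          FundamentalGroup.mapOfEq f h g := by
  subst h
  rw [joined_iff]
  refine exists_congr fun g => ?_
  have hg : FundamentalGroup.mapOfEq f rfl g = Path.Homotopic.Quotient.map g f :=
    (FundamentalGroup.mapOfEq_apply f rfl g).trans (Path.Homotopic.Quotient.cast_rfl_rfl _)
  exact Iff.of_eq (congrArg (fun r => Path.Homotopic.Quotient.mk l =
    Path.Homotopic.Quotient.trans r (Path.Homotopic.Quotient.mk l')) hg.symm)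

theorem exists_joined_ofPath_loop (f : C(S, T)) {x₀ : S} {y₀ : T} (h : f x₀ = y₀)
    (z : HoFiber f y₀) (hz : Joined z.1.1 x₀) :
    ∃ l : Path y₀ y₀, Joined z (ofPath f x₀ (l.cast h rfl)) := by
  subst h
  obtain ⟨q⟩ := hz
  refine ⟨(q.map f.continuous).symm.trans z.path, ?_⟩
  rw [joined_iff]
  refine ⟨Path.Homotopic.Quotient.mk q, ?_⟩
  have h1 : Path.Homotopic.Quotient.mk ((q.map f.continuous).symm.trans z.path) =
      ((Path.Homotopic.Quotient.mk q).map f).symm.trans (Path.Homotopic.Quotient.mk z.path) := rfl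
  refine Eq.trans ?_ (congrArg (Path.Homotopic.Quotient.trans
    ((Path.Homotopic.Quotient.mk q).map f)) h1.symm)
  rw [← Path.Homotopic.Quotient.trans_assoc]
  simp

end HoFiber

namespace Prespectrum.Hom

variable {X Y : Prespectrum.{u}} (f : X.Hom Y)

/-- Exactness at `Y`, in coset form: a path in the homotopy fibre between two loops over the base
point projects to a loop in `X (k + 1)`, that is, to a class in `π_{-k} X`. -/
theorem toCofiber_eq_iff (k : ℤ) (y y' : Y.homotopy k) :
    f.toCofiber k y = f.toCofiber k y' ↔
      ∃ g, Y.toLoops k y = Y.toLoops k y' * f.onLoops (k + 1) g := by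
  induction y using ZerothHomotopy.rec with | mk y =>
  induction y' using ZerothHomotopy.rec with | mk y' =>
  exact zerothHomotopy_mk_eq_iff.trans (HoFiber.joined_ofPath_loop_iff (f.app (k + 1))
    (f.app_pt (k + 1)) (Y.deloop k y) (Y.deloop k y'))

theorem toCofiber_zero (k : ℤ) : f.toCofiber k (Y.zero k) = f.cofiber.zero k := by
  refine congrArg ZerothHomotopy.mk (Subtype.ext (Prod.ext rfl (ContinuousMap.ext fun w => ?_)))
  exact congrArg (fun p => p w) (Y.deloop_pt k)

theorem exists_toCofiber_eq (hY : Y.IsPiZeroSpectrum) (k : ℤ) (c : f.cofiber.homotopy k)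
    (hc : f.boundary k c = X.zero (k + 1)) : ∃ y, f.toCofiber k y = c := by
  induction c using ZerothHomotopy.rec with | mk z =>
  obtain ⟨l, hl⟩ := HoFiber.exists_joined_ofPath_loop (f.app (k + 1)) (f.app_pt (k + 1)) z
    (zerothHomotopy_mk_eq_iff.mp hc)
  obtain ⟨y, hy⟩ := exists_joined_of_surjective_mapComponents (hY k).2 l
  refine ⟨ZerothHomotopy.mk y, zerothHomotopy_mk_eq_iff.mpr (Joined.trans ?_ hl.symm)⟩
  exact HoFiber.joined_ofPath_of_homotopic (f.app (k + 1)) (X.pt (k + 1))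
    (((joined_path_iff _ _).mp hy).pathCast (f.app_pt (k + 1)) rfl)

theorem onHomotopy_boundary (k : ℤ) (c : f.cofiber.homotopy k) :
    f.onHomotopy (k + 1) (f.boundary k c) = Y.zero (k + 1) := by
  induction c using ZerothHomotopy.rec with | mk z =>
  exact zerothHomotopy_mk_eq_iff.mpr ⟨HoFiber.path z⟩

theorem exists_boundary_eq (k : ℤ) (a : X.homotopy (k + 1))
    (ha : f.onHomotopy (k + 1) a = Y.zero (k + 1)) : ∃ c, f.boundary k c = a := by
  induction a using ZerothHomotopy.rec with | mk x =>
  obtain ⟨p⟩ := zerothHomotopy_mk_eq_iff.mp ha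
  exact ⟨ZerothHomotopy.mk (HoFiber.ofPath (f.app (k + 1)) x p), rfl⟩

theorem exists_onHomotopy_eq (hX : X.IsPiZeroSpectrum) (hY : Y.IsPiZeroSpectrum) (k : ℤ)
    (y : Y.homotopy k) (hy : f.toCofiber k y = f.cofiber.zero k) : ∃ x, f.onHomotopy k x = y := by
  rw [← toCofiber_zero, toCofiber_eq_iff] at hy
  obtain ⟨g, hg⟩ := hy
  obtain ⟨x, rfl⟩ := (hX.toLoops_bijective k).2 g
  refine ⟨x, (hY.toLoops_bijective k).1 ?_⟩
  rw [hg, toLoops_zero, one_mul, toLoops_onHomotopy]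

/-- Bijectivity on components is all that is needed to put a group structure on the homotopy of the
cofibre, and it uses only components and fundamental groups of the structure maps of `X` and `Y`. -/
theorem isPiZeroSpectrum_cofiber (hX : X.IsSpectrum) (hY : Y.IsSpectrum) :
    f.cofiber.IsPiZeroSpectrum := fun k =>
  HoFiber.bijective_mapComponents_loopMap (f.app (k + 1)) (f.app (k + 1 + 1)) (Y.pt (k + 1))
    (f.app_pt (k + 1 + 1)) (X.deloop (k + 1)) (Y.deloop (k + 1)) (Y.deloop_pt (k + 1))
    (f.comm (k + 1)) (hX (k + 1)) (hY (k + 1))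

end Prespectrum.Hom

namespace Prespectrum

/-- The map `π_{-k} X → π_{-k} Y` has trivial kernel. -/
def Hom.KernelTrivial {X Y : Prespectrum.{u}} (f : X.Hom Y) (k : ℤ) : Prop :=
  ∀ x, f.onHomotopy k x = Y.zero k → x = X.zero k

theorem IsPiZeroSpectrum.toLoops_mul {X : Prespectrum.{u}} (hX : X.IsPiZeroSpectrum) (k : ℤ)
    (x y : X.homotopy k) :
    letI := hX.group k
    X.toLoops k (x * y) = X.toLoops k x * X.toLoops k y :=
  (Equiv.ofBijective _ (hX.toLoops_bijective k)).apply_symm_apply _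

theorem IsPiZeroSpectrum.one_eq_zero {X : Prespectrum.{u}} (hX : X.IsPiZeroSpectrum) (k : ℤ) :
    letI := hX.group k
    (1 : X.homotopy k) = X.zero k :=
  (hX.toLoops_bijective k).1 <|
    ((Equiv.ofBijective _ (hX.toLoops_bijective k)).apply_symm_apply 1).trans
      (X.toLoops_zero k).symm

theorem Hom.onLoops_comm {X Y X' Y' : Prespectrum.{u}} (f : X.Hom Y) (f' : X'.Hom Y')
    (a : X.Hom X') (b : Y.Hom Y') (sq : ∀ k x, b.app k (f.app k x) = f'.app k (a.app k x))
    (k : ℤ) (p : FundamentalGroup (X.space k) (X.pt k)) :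
    b.onLoops k (f.onLoops k p) = f'.onLoops k (a.onLoops k p) := by
  obtain ⟨p, rfl⟩ := Path.Homotopic.Quotient.mk_surjective p
  rw [onLoops_mk, onLoops_mk, onLoops_mk, onLoops_mk]
  exact congrArg Path.Homotopic.Quotient.mk (Path.ext (funext fun v => sq k (p v)))

section CofiberMap

variable {X Y X' Y' : Prespectrum.{u}} (f : X.Hom Y) (f' : X'.Hom Y') (a : X.Hom X')
  (b : Y.Hom Y') (sq : ∀ k x, b.app k (f.app k x) = f'.app k (a.app k x))

theorem Hom.boundary_cofiberMap (k : ℤ) (c : f.cofiber.homotopy k) :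
    f'.boundary k ((f.cofiberMap f' a b sq).onHomotopy k c) =
      a.onHomotopy (k + 1) (f.boundary k c) := by
  induction c using ZerothHomotopy.rec with | mk z => rfl

theorem Hom.cofiberMap_toCofiber (k : ℤ) (y : Y.homotopy k) :
    (f.cofiberMap f' a b sq).onHomotopy k (f.toCofiber k y) =
      f'.toCofiber k (b.onHomotopy k y) := by
  induction y using ZerothHomotopy.rec with | mk y =>
  refine congrArg ZerothHomotopy.mk (Subtype.ext (Prod.ext (a.app_pt (k + 1))
    (ContinuousMap.ext fun w => ?_)))
  exact (b.comm k y w).symm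

end CofiberMap

end Prespectrum

/-! ### Exchanging the directions of a square -/

namespace HoFiber

theorem joined_base_iff {S T : Type u} [TopologicalSpace S] [TopologicalSpace T] {f : C(S, T)}
    {x₀ : S} {y₀ : T} (h : f x₀ = y₀) (z : HoFiber f y₀) :
    Joined z (base h) ↔ ∃ q : Path.Homotopic.Quotient z.1.1 x₀,
      Path.Homotopic.Quotient.mk z.path = (q.map f).cast rfl h.symm := by
  subst h
  rw [joined_iff]
  refine exists_congr fun q => Iff.of_eq (congrArg _ ?_)
  exact (Path.Homotopic.Quotient.trans_refl (q.map f)).trans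
    (Path.Homotopic.Quotient.cast_rfl_rfl (q.map f)).symm

/-- For a commutative square of pointed spaces, a point of the homotopy fibre of `f` over the base
component of the homotopy fibre of `h` lies in the base component, provided that this holds with the
directions of the square exchanged and that `i` is injective on loops. -/
theorem joined_base_of_square {A B C D : Type u} [TopologicalSpace A] [TopologicalSpace B]
    [TopologicalSpace C] [TopologicalSpace D] (f : C(A, B)) (g : C(A, C)) (i : C(B, D))
    (h : C(C, D)) (hc : ∀ x, h (g x) = i (f x)) {a₀ : A} {b₀ : B} {c₀ : C} {d₀ : D}
    (hf : f a₀ = b₀) (hg : g a₀ = c₀) (hi : i b₀ = d₀) (hh : h c₀ = d₀)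
    (hfib : ∀ (x : A) (γ : Path (g x) c₀),
      Joined (ofPath i (f x) ((γ.map h.continuous).cast (hc x).symm hh.symm)) (base hi) →
        Joined (ofPath g x γ) (base hg))
    (hloop : ∀ l : FundamentalGroup B b₀, FundamentalGroup.mapOfEq i hi l = 1 → l = 1)
    (x : A) (β : Path (f x) b₀)
    (hβ : Joined (ofPath h (g x) ((β.map i.continuous).cast (hc x) hi.symm)) (base hh)) :
    Joined (ofPath f x β) (base hf) := by
  subst hf hg hi
  -- Nullity in the fibre of `h` gives `γ` with `h γ ≃ i β`. Read the other way, `β` shows that `(x,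
  -- γ)` becomes null in the fibre of `i`, so `hfib` yields `α` from `x` to the base point with `g α
  -- ≃ γ`.
  obtain ⟨γ, hγ⟩ : ∃ γ : Path (g x) (g a₀),
      ((Path.Homotopic.Quotient.mk β).map i).cast (hc x) rfl =
        ((Path.Homotopic.Quotient.mk γ).map h).cast rfl hh.symm := by
    obtain ⟨q, hq⟩ := (joined_base_iff _ _).mp hβ
    obtain ⟨γ, rfl⟩ := Path.Homotopic.Quotient.mk_surjective q
    exact ⟨γ, hq⟩
  obtain ⟨α, hα⟩ : ∃ α : Path.Homotopic.Quotient x a₀,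
      Path.Homotopic.Quotient.mk γ = α.map g := by
    have h1 : Joined (ofPath g x γ) (base rfl) := by
      refine hfib x γ ((joined_base_iff _ _).mpr ⟨Path.Homotopic.Quotient.mk β, ?_⟩)
      have h2 := congrArg (fun r => Path.Homotopic.Quotient.cast r (hc x).symm rfl) hγ
      simp only [Path.Homotopic.Quotient.cast_cast] at h2
      exact h2.symm
    obtain ⟨α, hα⟩ := (joined_base_iff _ _).mp h1
    exact ⟨α, hα.trans (Path.Homotopic.Quotient.cast_rfl_rfl _)⟩
  have h2 : (Path.Homotopic.Quotient.mk β).map i = (α.map f).map i := by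
    refine pathClass_cast_injective (hc x) rfl ?_
    simp only
    rw [hγ, hα, ← Path.Homotopic.Quotient.map_comp, ← Path.Homotopic.Quotient.map_comp,
      pathClass_map_congr (f := h.comp g) (g := i.comp f) hc]
    exact Path.Homotopic.Quotient.cast_cast _ _ _ _ _
  -- Now `i β ≃ h γ ≃ h g α = i f α`, so the loop formed by `f α` reversed and `β` is killed by `i`;
  -- hence it is trivial and `β ≃ f α`.
  have h3 : (Path.Homotopic.Quotient.map α f).symm.trans (Path.Homotopic.Quotient.mk β) =
      Path.Homotopic.Quotient.refl (f a₀) := by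
    refine hloop _ ((FundamentalGroup.mapOfEq_apply i rfl _).trans
      ((Path.Homotopic.Quotient.cast_rfl_rfl _).trans ?_))
    rw [pathClass_map_trans, pathClass_map_symm, h2]
    exact Path.Homotopic.Quotient.symm_trans _
  refine (joined_base_iff _ _).mpr ⟨α, ?_⟩
  refine Eq.trans ?_ (Path.Homotopic.Quotient.cast_rfl_rfl _).symm
  have h4 := congrArg (Path.Homotopic.Quotient.trans (Path.Homotopic.Quotient.map α f)) h3
  rw [← Path.Homotopic.Quotient.trans_assoc, Path.Homotopic.Quotient.trans_symm,
    Path.Homotopic.Quotient.refl_trans, Path.Homotopic.Quotient.trans_refl] at h4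
  exact h4

end HoFiber

namespace Prespectrum

/-- Both cofibre maps have the same total cofibre, but the chase needs only injectivity of `i` in
the same degree: loops in `X (k + 1)` represent `π_{-k} X`. -/
theorem Hom.KernelTrivial.cofiberMap_flip {W X Y Z : Prespectrum.{u}} {f : W.Hom X} {g : W.Hom Y}
    {i : X.Hom Z} {h : Y.Hom Z} (sq : ∀ k x, i.app k (f.app k x) = h.app k (g.app k x))
    (hX : X.IsPiZeroSpectrum) (hZ : Z.IsPiZeroSpectrum) {k : ℤ}
    (hgi : (g.cofiberMap i f h fun k x => (sq k x).symm).KernelTrivial k)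
    (hi : i.KernelTrivial k) : (f.cofiberMap h g i sq).KernelTrivial k := by
  intro c hc
  induction c using ZerothHomotopy.rec with | mk z =>
  refine zerothHomotopy_mk_eq_iff.mpr ?_
  refine HoFiber.joined_base_of_square (f.app (k + 1)) (g.app (k + 1)) (i.app (k + 1))
    (h.app (k + 1)) (fun x => (sq (k + 1) x).symm) (f.app_pt (k + 1)) (g.app_pt (k + 1))
    (i.app_pt (k + 1)) (h.app_pt (k + 1)) ?_ ?_ z.1.1 z.path (zerothHomotopy_mk_eq_iff.mp hc)
  · intro x γ hγ
    exact zerothHomotopy_mk_eq_iff.mp (hgi (ZerothHomotopy.mk (HoFiber.ofPath _ x γ))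
      (zerothHomotopy_mk_eq_iff.mpr hγ))
  · intro l hl
    obtain ⟨x, rfl⟩ := (hX.toLoops_bijective k).2 l
    rw [← toLoops_zero]
    refine congrArg _ (hi x ((hZ.toLoops_bijective k).1 ?_))
    rw [toLoops_onHomotopy, toLoops_zero]
    exact hl

end Prespectrum

/-! ### Parity of differentials and injectivity of towers -/

namespace FilteredPrespectrum

variable (F : FilteredPrespectrum.{u})

theorem onHomotopy_refl (s k : ℤ) (x : (F.obj s).homotopy k) :
    (F.map (le_refl s)).onHomotopy k x = x := by
  induction x using ZerothHomotopy.rec with | mk x =>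
  exact congrArg ZerothHomotopy.mk (F.map_refl s k x)

theorem onHomotopy_trans {a b c : ℤ} (h : a ≤ b) (h' : b ≤ c) (k : ℤ)
    (x : (F.obj c).homotopy k) :
    (F.map h).onHomotopy k ((F.map h').onHomotopy k x) = (F.map (h.trans h')).onHomotopy k x :=
  Prespectrum.Hom.onHomotopy_onHomotopy _ _ _ k (F.map_trans h h' k) x

/-- The inverse limit of the tower `π_{-k} F^s` is trivial. -/
def LimTrivial (k : ℤ) : Prop :=
  ∀ a : ∀ s, (F.obj s).homotopy k, (∀ s, (F.step s).onHomotopy k (a (s + 1)) = a s) →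
    ∀ s, a s = (F.obj s).zero k

variable {F}

/-- A coherent family of classes lifts to a point of the homotopy limit after choosing connecting
paths; a path from it to the base point projects to every stage. -/
theorem IsComplete.limTrivial (hF : F.IsComplete) (k : ℤ) : F.LimTrivial k := by
  intro a ha s
  choose x hx using fun s => ZerothHomotopy.mk_surjective (a s)
  have hp : ∀ s, Joined (x s) ((F.step s).app k (x (s + 1))) := fun s => by
    refine zerothHomotopy_mk_eq_iff.mp ?_
    rw [hx, ← ha s, ← hx]
    rfl
  have p := fun s => (hp s).somePath
  let z : F.HolimSpace k :=
    ⟨(x, fun s => (p s).toContinuousMap), fun s => ⟨(p s).source, (p s).target⟩⟩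
  obtain ⟨γ⟩ : Joined z (F.holimBase k) :=
    zerothHomotopy_mk_eq_iff.mp (hF k (ZerothHomotopy.mk z))
  rw [← hx]
  exact zerothHomotopy_mk_eq_iff.mpr ⟨γ.map ((continuous_apply s).comp
    (continuous_fst.comp continuous_subtype_val))⟩

/-- The first derived limit of the tower of loops in a complete filtered spectrum is trivial. -/
theorem IsComplete.exists_loops (hF : F.IsComplete) (k : ℤ)
    (g : ∀ s, FundamentalGroup ((F.obj s).space k) ((F.obj s).pt k)) :
    ∃ m : ∀ s, FundamentalGroup ((F.obj s).space k) ((F.obj s).pt k),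
      ∀ s, m s = g s * (F.step s).onLoops k (m (s + 1)) := by
  have hinv : ∀ s, ∃ p : Path ((F.obj s).pt k) ((F.obj s).pt k),
      FundamentalGroup.fromPath (Path.Homotopic.Quotient.mk p) = (g s)⁻¹ := fun s =>
    Path.Homotopic.Quotient.mk_surjective _
  choose p hp using hinv
  -- All components of this point are base points, and its connecting paths are loops representing
  -- `(g s)⁻¹`. A path to the base point of the homotopy limit traces a loop `q s` at each stage,
  -- and these solve the required equation up to inversion.
  let z : F.HolimSpace k :=
    ⟨(fun s => (F.obj s).pt k, fun s => (p s).toContinuousMap),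
      fun s => ⟨(p s).source, (p s).target.trans ((F.step s).app_pt k).symm⟩⟩
  obtain ⟨γ⟩ : Joined z (F.holimBase k) :=
    zerothHomotopy_mk_eq_iff.mp (hF k (ZerothHomotopy.mk z))
  let q : ∀ s, Path ((F.obj s).pt k) ((F.obj s).pt k) := fun s =>
    { toFun := fun v => (γ v).1.1 s
      continuous_toFun := (continuous_apply s).comp
        (continuous_fst.comp (continuous_subtype_val.comp γ.continuous))
      source' := congrArg (fun y => y.1.1 s) γ.source
      target' := congrArg (fun y => y.1.1 s) γ.target }
  let m : ∀ s, FundamentalGroup ((F.obj s).space k) ((F.obj s).pt k) := fun s =>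
    FundamentalGroup.fromPath (Path.Homotopic.Quotient.mk (q s))
  -- The square swept out by the connecting path gives this relation. Products in `FundamentalGroup`
  -- are in the opposite order to `trans`.
  have key : ∀ s, (F.step s).onLoops k (m (s + 1)) * (g s)⁻¹ = m s := fun s => by
    have hcont : Continuous fun v : I × I => (γ v.1).1.2 s v.2 :=
      Continuous.eval ((continuous_apply s).comp (continuous_snd.comp
        (continuous_subtype_val.comp (γ.continuous.comp continuous_fst)))) continuous_snd
    have h1 := pathClass_of_square ⟨_, hcont⟩ (p s) (Path.refl _) (q s)
      (((q (s + 1)).map ((F.step s).app k).continuous).cast ((F.step s).app_pt k).symm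
        ((F.step s).app_pt k).symm)
      (fun t => congrArg (fun y => y.1.2 s t) γ.source)
      (fun t => congrArg (fun y => y.1.2 s t) γ.target)
      (fun t => ((γ t).2 s).1) (fun t => ((γ t).2 s).2)
    rw [← hp s]
    refine Eq.trans ?_ (h1.trans (Path.Homotopic.Quotient.trans_refl _))
    exact congrArg (Path.Homotopic.Quotient.trans (Path.Homotopic.Quotient.mk (p s)))
      ((F.step s).onLoops_mk k (q (s + 1)))
  refine ⟨fun s => (m s)⁻¹, fun s => ?_⟩
  simp only [← key s, map_inv, mul_inv_rev, inv_inv]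

/-- For `x` of odd degree, `∂ x` lies in the kernel of `F^{s+1} → F^s` in even degree, so it
vanishes; every lift of it then witnesses that the target is zero on the page. -/
theorem evenToOdd_of_kernelTrivial (h : ∀ s k, Even k → (F.step s).KernelTrivial k) :
    F.EvenToOdd := by
  rintro r hr s k x y ⟨w, hw, hy⟩ hz
  rcases Int.even_or_odd k with hk | hk
  · exact ⟨hk.neg, (hk.add_one).neg⟩
  · refine absurd ⟨w, ?_, hy⟩ hz
    rw [hw]
    exact h s (k + 1) hk.add_one _ ((F.step s).onHomotopy_boundary k x)

theorem EvenToOdd.kernelTrivial_step (h : F.EvenToOdd) (hF : ∀ s, (F.obj s).IsPiZeroSpectrum)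
    (hlim : ∀ k, F.LimTrivial k) (s : ℤ) {k : ℤ} (hk : Even k) : (F.step s).KernelTrivial k := by
  -- With this shift, the source of a differential into the degree considered has total degree `-k`,
  -- which is odd, so the target must be zero on its page.
  obtain ⟨k, rfl⟩ : ∃ n, k = n + 1 := ⟨k - 1, by ring⟩
  have hodd : ¬ Even (-k) := fun h' => by
    rw [even_neg] at h'
    exact (Int.not_even_iff_odd.mpr h'.add_one) hk
  let : ∀ s, Group ((F.obj s).homotopy (k + 1)) := fun s => (hF s).group (k + 1)
  have hone : ∀ s, (1 : (F.obj s).homotopy (k + 1)) = (F.obj s).zero (k + 1) := fun s =>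
    (hF s).one_eq_zero (k + 1)
  have hmul : ∀ s (x y : (F.obj s).homotopy (k + 1)), (F.obj s).toLoops (k + 1) (x * y) =
      (F.obj s).toLoops (k + 1) x * (F.obj s).toLoops (k + 1) y := fun s =>
    (hF s).toLoops_mul (k + 1)
  let φ : ∀ {a b : ℤ}, a ≤ b → (F.obj b).homotopy (k + 1) →* (F.obj a).homotopy (k + 1) :=
    fun {a b} h => MonoidHom.mk' ((F.map h).onHomotopy (k + 1)) fun x y =>
      ((hF a).toLoops_bijective (k + 1)).1 <| by
        rw [hmul, Prespectrum.Hom.toLoops_onHomotopy, Prespectrum.Hom.toLoops_onHomotopy,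
          Prespectrum.Hom.toLoops_onHomotopy, hmul, map_mul]
  intro x hx
  rw [← hone] at hx ⊢
  refine eq_one_of_map_eq_one φ (fun s x => F.onHomotopy_refl s (k + 1) x)
    (fun h h' x => F.onHomotopy_trans h h' (k + 1) x)
    (fun a ha s => (hlim (k + 1) a ha s).trans (hone s).symm) ?_ s x hx
  intro r hr s w hw
  -- The image of `w` in `F^{s+1}` is a boundary `∂ c`, so `j w` represents `d_r [c]`. Its vanishing
  -- gives `w'` with `j w' = j w`, and exactness supplies `v`.
  obtain ⟨c, hc⟩ := (F.step s).exists_boundary_eq k ((F.map (add_le_add_right hr s)).onHomotopy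
    (k + 1) w) (hw.trans (hone s))
  obtain ⟨w', hw', hj⟩ : F.IsZeroOnPage r hr s (k + 1) ((F.step (s + r)).toCofiber (k + 1) w) := by
    by_contra hz
    exact hodd (h r hr s k c _ ⟨w, hc.symm, rfl⟩ hz).1
  obtain ⟨g, hg⟩ := ((F.step (s + r)).toCofiber_eq_iff (k + 1) w w').mp hj.symm
  obtain ⟨v, rfl⟩ := ((hF (s + r + 1)).toLoops_bijective (k + 1)).2 g
  refine ⟨w', v, hw'.trans (hone _).symm, ((hF (s + r)).toLoops_bijective (k + 1)).1 ?_⟩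
  rw [hg, hmul, ← Prespectrum.Hom.toLoops_onHomotopy]
  rfl

theorem kernelTrivial_map {k : ℤ} (h : ∀ s, (F.step s).KernelTrivial k) {a b : ℤ} (hab : a ≤ b) :
    (F.map hab).KernelTrivial k := by
  induction b, hab using Int.leInduction with
  | base => intro x hx; rwa [onHomotopy_refl] at hx
  | succ b hab ih =>
    intro x hx
    refine h b x (ih _ ?_)
    exact (F.onHomotopy_trans hab (le_of_lt (lt_add_one b)) k x).trans hx

/-- The inverse limit of the homotopy of the cofibres of a map of complete filtered spectra is
trivial. -/
theorem IsComplete.cofiber_eq_zero {X Y : FilteredPrespectrum.{u}} (hX : X.IsComplete)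
    (hY : Y.IsComplete) (hY' : ∀ s, (Y.obj s).IsPiZeroSpectrum) (f : ∀ s, (X.obj s).Hom (Y.obj s))
    (sq : ∀ s k x, (Y.step s).app k ((f (s + 1)).app k x) = (f s).app k ((X.step s).app k x))
    (k : ℤ) (c : ∀ s, (f s).cofiber.homotopy k)
    (hc : ∀ s, ((f (s + 1)).cofiberMap (f s) (X.step s) (Y.step s) (sq s)).onHomotopy k
      (c (s + 1)) = c s) (s : ℤ) : c s = (f s).cofiber.zero k := by
  -- The boundaries of the `c s` form a coherent family, hence vanish, so each `c s` comes from some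
  -- `y s`.
  have hbd := hX.limTrivial (k + 1) (fun s => (f s).boundary k (c s)) (fun s => by
    rw [← Prespectrum.Hom.boundary_cofiberMap _ _ _ _ (sq s), hc s])
  choose y hy using fun s => (f s).exists_toCofiber_eq (hY' s) k (c s) (hbd s)
  have hg : ∀ s, ∃ g, (Y.obj s).toLoops k ((Y.step s).onHomotopy k (y (s + 1))) =
      (Y.obj s).toLoops k (y s) * (f s).onLoops (k + 1) g := fun s => by
    rw [← Prespectrum.Hom.toCofiber_eq_iff, hy s,
      ← Prespectrum.Hom.cofiberMap_toCofiber _ _ _ _ (sq s), hy (s + 1), hc s]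
  choose g hg using hg
  -- The `y s` are coherent only up to the images of the `g s`. Vanishing of `lim¹` gives
  -- corrections `m s` making `y s * f (m s)` coherent, hence trivial; thus `y s` lies in the image
  -- of `f`.
  obtain ⟨m, hm⟩ := hX.exists_loops (k + 1) g
  choose z hz using fun s => ((hY' s).toLoops_bijective k).2
    ((Y.obj s).toLoops k (y s) * (f s).onLoops (k + 1) (m s))
  have hz0 := hY.limTrivial k z (fun s => by
    refine ((hY' s).toLoops_bijective k).1 ?_
    rw [Prespectrum.Hom.toLoops_onHomotopy, hz, map_mul, ← Prespectrum.Hom.toLoops_onHomotopy,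
      hg, Prespectrum.Hom.onLoops_comm _ _ _ _ (sq s), hz s, hm s, map_mul, mul_assoc])
  rw [← hy s, ← Prespectrum.Hom.toCofiber_zero, Prespectrum.Hom.toCofiber_eq_iff]
  refine ⟨(m s)⁻¹, ?_⟩
  have h := hz s
  rw [hz0 s, Prespectrum.toLoops_zero] at h
  rw [Prespectrum.toLoops_zero, one_mul, map_inv]
  exact eq_inv_of_mul_eq_one_left h.symm

end FilteredPrespectrum

/-! ### Injectivity on even homotopy in the bifiltration -/

namespace BifilteredSpectrum

variable (A : BifilteredSpectrum.{u})

theorem onHomotopy_trans {s s' s'' t t' t'' : WithBot ℤ} (hs : s ≤ s') (hs' : s' ≤ s'')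
    (ht : t ≤ t') (ht' : t' ≤ t'') (k : ℤ) (x : (A.obj s'' t'').homotopy k) :
    (A.map hs ht).onHomotopy k ((A.map hs' ht').onHomotopy k x) =
      (A.map (hs.trans hs') (ht.trans ht')).onHomotopy k x :=
  Prespectrum.Hom.onHomotopy_onHomotopy _ _ _ k (A.map_trans hs hs' ht ht' k) x

theorem limTrivial_verticalGr {A : BifilteredSpectrum.{u}} (hA : A.IsComplete) (t k : ℤ) :
    (A.verticalGr t).LimTrivial k := fun c hc =>
  FilteredPrespectrum.IsComplete.cofiber_eq_zero (hA.1 ((t + 1 : ℤ) : WithBot ℤ))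
    (hA.1 (t : WithBot ℤ)) (fun _ => (A.isSpectrum _ _).isPiZeroSpectrum)
    (fun s => (A.vertical s).step t)
    (fun _ k x => (A.map_trans _ _ _ _ k x).trans (A.map_trans _ _ _ _ k x).symm) k c hc

theorem kernelTrivial_verticalGr {A : BifilteredSpectrum.{u}} (hA : A.IsComplete)
    (h : A.ClockwiseEvenToOdd) {k : ℤ} (hk : Even k) (t : ℤ) {a b : ℤ} (hab : a ≤ b) :
    ((A.verticalGr t).map hab).KernelTrivial k :=
  FilteredPrespectrum.kernelTrivial_map (fun s => (h.1 t).kernelTrivial_step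
    (fun s => ((A.vertical s).step t).isPiZeroSpectrum_cofiber (A.isSpectrum _ _)
      (A.isSpectrum _ _)) (limTrivial_verticalGr hA t) s hk) hab

theorem kernelTrivial_vertical_bot {A : BifilteredSpectrum.{u}} (hA : A.IsComplete)
    (h : A.ClockwiseEvenToOdd) {k : ℤ} (hk : Even k) {a b : ℤ} (hab : a ≤ b) :
    ((A.vertical ⊥).map hab).KernelTrivial k :=
  FilteredPrespectrum.kernelTrivial_map (fun s => h.2.kernelTrivial_step
    (fun _ => (A.isSpectrum _ _).isPiZeroSpectrum) (fun k => (hA.2 ⊥).limTrivial k) s hk) hab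

/-- In even degrees, the homotopy of `F^{s,t} A` injects into the homotopy of `F^{-∞,t} A`. -/
theorem kernelTrivial_map_bot {A : BifilteredSpectrum.{u}} (hex : A.IsExhaustive)
    (hA : A.IsComplete) (h : A.ClockwiseEvenToOdd) {k : ℤ} (hk : Even k) (s t : ℤ) :
    (A.map (bot_le : ⊥ ≤ (s : WithBot ℤ)) (le_refl (t : WithBot ℤ))).KernelTrivial k := by
  intro a ha
  -- The family to be lifted in `t`, for fixed `s`, consists of the classes that die in `F^{-∞,t}
  -- A`.
  refine eq_of_liftable (G := fun t => ((A.vertical s).obj t).homotopy k)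
    (fun h => ((A.vertical s).map h).onHomotopy k)
    (fun t x => (A.vertical s).onHomotopy_refl t k x)
    (fun h h' x => (A.vertical s).onHomotopy_trans h h' k x)
    (fun t => ((A.vertical s).obj t).zero k) ((hA.2 s).limTrivial k)
    (fun t x => (A.map (bot_le : ⊥ ≤ (s : WithBot ℤ)) (le_refl (t : WithBot ℤ))).onHomotopy k x =
      (A.obj ⊥ t).zero k) ?_ ha
  clear ha a t
  intro t a ha
  obtain ⟨s', hs', ha'⟩ := (hex.1 t).2 k s a ((A.obj s t).zero k)
    (ha.trans (Prespectrum.Hom.onHomotopy_zero _ k).symm)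
  -- As `a` dies in `F^{s',t}`, its image in `F^{s',t}/F^{s',t+1}` is zero, and `F^{s,t}/F^{s,t+1}`
  -- injects there on even homotopy.
  have hj : ((A.vertical s).step t).toCofiber k a = ((A.vertical s).gr t).zero k := by
    refine kernelTrivial_verticalGr hA h hk t hs' _ ?_
    refine (Prespectrum.Hom.cofiberMap_toCofiber _ ((A.vertical s').step t) _ _
      (fun k x => (A.map_trans _ _ _ _ k x).trans (A.map_trans _ _ _ _ k x).symm) k a).trans ?_
    refine (congrArg _ (ha'.trans (Prespectrum.Hom.onHomotopy_zero _ k))).trans ?_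
    exact Prespectrum.Hom.toCofiber_zero _ k
  obtain ⟨x, hx⟩ := ((A.vertical s).step t).exists_onHomotopy_eq
    (A.isSpectrum _ _).isPiZeroSpectrum (A.isSpectrum _ _).isPiZeroSpectrum k a hj
  -- The lift `x` dies in `F^{-∞,t}`, hence already in `F^{-∞,t+1}` by injectivity of the vertical
  -- tower, so it stays in the family.
  refine ⟨x, kernelTrivial_vertical_bot hA h hk (le_of_lt (lt_add_one t)) _ ?_, hx⟩
  refine Eq.trans ?_ ha
  rw [← hx]
  exact (A.onHomotopy_trans _ _ _ _ k x).trans (A.onHomotopy_trans _ _ _ _ k x).symm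

/-- Pushing the class on to `F^{-∞,t}` factors through `F^{s',t'} → F^{-∞,t'} → F^{-∞,t}`, both of
which are injective in even degree. -/
theorem kernelTrivial_map {A : BifilteredSpectrum.{u}} (hex : A.IsExhaustive)
    (hA : A.IsComplete) (h : A.ClockwiseEvenToOdd) {k : ℤ} (hk : Even k) {s s' t t' : ℤ}
    (hs : (s : WithBot ℤ) ≤ s') (ht : (t : WithBot ℤ) ≤ t') :
    (A.map hs ht).KernelTrivial k := by
  intro a ha
  refine kernelTrivial_map_bot hex hA h hk s' t' a
    (kernelTrivial_vertical_bot hA h hk (WithBot.coe_le_coe.mp ht) _ ?_)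
  refine (A.onHomotopy_trans _ _ _ _ k a).trans ?_
  refine (A.onHomotopy_trans bot_le hs (le_refl _) ht k a).symm.trans ?_
  rw [ha]
  exact Prespectrum.Hom.onHomotopy_zero _ k

/-- A kernel element is represented at a finite stage `t`, and its image in `F^{s,t}` dies at some
`t' ≤ t`; injectivity of `F^{s+1,t'} → F^{s,t'}` kills the representative there. -/
theorem kernelTrivial_horizontal_bot {A : BifilteredSpectrum.{u}} (hex : A.IsExhaustive)
    (hA : A.IsComplete) (h : A.ClockwiseEvenToOdd) {k : ℤ} (hk : Even k) (s : ℤ) :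
    ((A.horizontal ⊥).step s).KernelTrivial k := by
  intro a ha
  obtain ⟨t, b, rfl⟩ := (hex.2 ((s + 1 : ℤ) : WithBot ℤ)).1 k a
  have hs : (s : WithBot ℤ) ≤ (s + 1 : ℤ) := WithBot.coe_le_coe.mpr (le_of_lt (lt_add_one s))
  obtain ⟨t', ht', hb⟩ := (hex.2 (s : WithBot ℤ)).2 k t
    ((A.map hs (le_refl (t : WithBot ℤ))).onHomotopy k b) ((A.obj s t).zero k) (by
      refine (A.onHomotopy_trans _ _ _ _ k b).trans ?_
      refine ((A.onHomotopy_trans hs (le_refl _) (le_refl _) bot_le k b).symm.trans ha).trans ?_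
      exact (Prespectrum.Hom.onHomotopy_zero _ k).symm)
  have hb0 : (A.map (le_refl ((s + 1 : ℤ) : WithBot ℤ))
      (WithBot.coe_le_coe.mpr ht')).onHomotopy k b = (A.obj (s + 1 : ℤ) t').zero k := by
    refine kernelTrivial_map hex hA h hk hs (le_refl (t' : WithBot ℤ)) _ ?_
    refine (A.onHomotopy_trans _ _ _ _ k b).trans ?_
    refine (A.onHomotopy_trans (le_refl _) hs (WithBot.coe_le_coe.mpr ht') (le_refl _)
      k b).symm.trans ?_
    exact hb.trans (Prespectrum.Hom.onHomotopy_zero _ k)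
  refine (A.onHomotopy_trans (le_refl _) (le_refl _) bot_le
    (WithBot.coe_le_coe.mpr ht') k b).symm.trans ?_
  rw [hb0]
  exact Prespectrum.Hom.onHomotopy_zero _ k

theorem kernelTrivial_horizontalGr {A : BifilteredSpectrum.{u}} (hex : A.IsExhaustive)
    (hA : A.IsComplete) (h : A.ClockwiseEvenToOdd) {k : ℤ} (hk : Even k) (s t : ℤ) :
    ((A.horizontalGr s).step t).KernelTrivial k :=
  Prespectrum.Hom.KernelTrivial.cofiberMap_flip
    (fun k x => (A.map_trans _ _ _ _ k x).trans (A.map_trans _ _ _ _ k x).symm)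
    (A.isSpectrum _ _).isPiZeroSpectrum (A.isSpectrum _ _).isPiZeroSpectrum
    (kernelTrivial_verticalGr hA h hk t (le_of_lt (lt_add_one s)))
    (kernelTrivial_map hex hA h hk _ _)

end BifilteredSpectrum
end StableHomotopy

theorem lemmal (A : StableHomotopy.BifilteredSpectrum.{u}) (hexhaustive : A.IsExhaustive)
    (hcomplete : A.IsComplete) (hclockwise : A.ClockwiseEvenToOdd) :
    A.CounterclockwiseEvenToOdd := by
  exact ⟨fun s => StableHomotopy.FilteredPrespectrum.evenToOdd_of_kernelTrivial fun t _ hk =>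
    StableHomotopy.BifilteredSpectrum.kernelTrivial_horizontalGr hexhaustive hcomplete hclockwise
      hk s t,
  StableHomotopy.FilteredPrespectrum.evenToOdd_of_kernelTrivial fun s _ hk =>
    StableHomotopy.BifilteredSpectrum.kernelTrivial_horizontal_bot hexhaustive hcomplete hclockwise
      hk s⟩
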